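/- **Local uniqueness of the tri-linear Nambu bracket.** Let $U\subseteq\mathbb R^N$ be open; observables on $U$ are the functions in $C^\infty(U)$. A *Nambu tensor* on $U$ is a smooth, totally antisymmetric tensor $\lambda_{ijk}$ on $U$ whose bracket $\{A,B,C\}=\sum_{i,j,k}\lambda_{ijk}\,\partial_iA\,\partial_jB\,\partial_kC$ satisfies the fundamental identity $$\{\{A,B,C\},D,E\}=\{\{A,D,E\},B,C\}+\{A,\{B,D,E\},C\}+\{A,B,\{C,D,E\}\}$$ for all observables $A,B,C,D,E$ on $U$. A *Poisson tensor* on $U$ is a smooth antisymmetric matrix $J_{ij}$ on $U$ whose bracket $\{A,B\}=\sum_{i,j}J_{ij}\,\partial_iA\,\partial_jB$ satisfies the Jacobi identity for all observables. A local change of coordinates $h$ is a $C^\infty$ diffeomorphism between open subsets of $\mathbb R^N$; it transforms $\lambda$ into $\widetilde\lambda_{ijk}=\{h_i,h_j,h_k\}\circ h^{-1}$ and $J$ into $\widetilde J_{ij}=\{h_i,h_j\}\circ h^{-1}$. 1. Let $N=K+2$, let $J$ be a Poisson tensor on the open set $U\subseteq\mathbb R^N$ of constant rank $N-K$ (that is,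 with $K$ Casimir invariants), and suppose that its bracket is generated by a Nambu bracket on $U$ with Nambu tensor $\lambda$ through an observable $C$, i.e. $\{A,B\}=\{A,B,C\}$ for all observables $A,B$ on $U$. Then every point of $U$ has a neighbourhood in $U$ with a change of coordinates $x=h(z)$ in which $C=x_N$, the Poisson matrix is constant with $\widetilde J_{12}=-\widetilde J_{21}=1$ and all other entries $0$, and the Nambu tensor is constant: $\widetilde\lambda_{ijk}$ is the Levi-Civita symbol of the indices $(1,2,N)$ (so $\widetilde\lambda_{12N}=1$) if $i,j,k\in\{1,2,N\}$, and $\widetilde\lambda_{ijk}=0$ otherwise. 2. For every $N\ge3$, consider all Nambu tensors defined on an open neighbourhood of some point $p$ of $\mathbb R^N$ and nonzero at $p$, and call two of them equivalent if a local change of coordinates from a neighbourhood of one base point to a neighbourhood of the other, mapping base point to base point, transforms one tensor into the other. There is exactly one equivalence class. 3. For every $N\geq 0$, the Poisson tensors defined, with constant nonzero rank, on an open neighbourhood of some point of $\mathbb R^N$ form exactly $\lfloor N/2\rfloor$ classes under the analogous equivalence. -/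

import Mathlib

open scoped ContDiff

noncomputable section

namespace NambuLocal

/-- The phase space `ℝ^N`; only its smooth structure is used. -/
abbrev Phase (N : ℕ) : Type := Fin N → ℝ

/-- The partial derivative `∂A/∂z_i` at `z`. -/
def pderiv {N : ℕ} (i : Fin N) (A : Phase N → ℝ) (z : Phase N) : ℝ :=
  fderiv ℝ A z (Pi.single i 1)

/-- The observables on an open set `U` are the smooth functions on `U`. -/
def IsObservable {N : ℕ} (U : Set (Phase N)) (A : Phase N → ℝ) : Prop :=
  ContDiffOn ℝ ∞ A U

/-- A field of trivalent tensors, given by its components. -/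
abbrev TriTensor (N : ℕ) : Type := Phase N → Fin N → Fin N → Fin N → ℝ

/-- A field of bivalent tensors, given by its components. -/
abbrev BiTensor (N : ℕ) : Type := Phase N → Matrix (Fin N) (Fin N) ℝ

/-- `{A, B, C} = T_{ijk} ∂_i A ∂_j B ∂_k C`. -/
def nambuBracket {N : ℕ} (T : TriTensor N) (A B C : Phase N → ℝ) (z : Phase N) : ℝ :=
  ∑ i, ∑ j, ∑ k, T z i j k * pderiv i A z * pderiv j B z * pderiv k C z

/-- `{A, B} = J_{ij} ∂_i A ∂_j B`. -/
def poissonBracket {N : ℕ} (J : BiTensor N) (A B : Phase N → ℝ) (z : Phase N) : ℝ :=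
  ∑ i, ∑ j, J z i j * pderiv i A z * pderiv j B z

/-- `T` is a Nambu tensor on `U`: smooth, totally antisymmetric, and its bracket satisfies the
fundamental identity for all observables. -/
structure IsNambuTensor {N : ℕ} (U : Set (Phase N)) (T : TriTensor N) : Prop where
  smooth : ∀ i j k, IsObservable U (fun z => T z i j k)
  antisymm_left : ∀ z ∈ U, ∀ i j k, T z j i k = -T z i j k
  antisymm_right : ∀ z ∈ U, ∀ i j k, T z i k j = -T z i j k
  fundamental : ∀ A B C D E : Phase N → ℝ,
    IsObservable U A → IsObservable U B → IsObservable U C → IsObservable U D →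
    IsObservable U E → ∀ z ∈ U,
      nambuBracket T (nambuBracket T A B C) D E z =
        nambuBracket T (nambuBracket T A D E) B C z
          + nambuBracket T A (nambuBracket T B D E) C z
          + nambuBracket T A B (nambuBracket T C D E) z

/-- `J` is a Poisson tensor on `U`: smooth, antisymmetric, and its bracket satisfies the
Jacobi identity for all observables. -/
structure IsPoissonTensor {N : ℕ} (U : Set (Phase N)) (J : BiTensor N) : Prop where
  smooth : ∀ i j, IsObservable U (fun z => J z i j)
  antisymm : ∀ z ∈ U, ∀ i j, J z j i = -J z i j
  jacobi : ∀ A B D : Phase N → ℝ,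
    IsObservable U A → IsObservable U B → IsObservable U D → ∀ z ∈ U,
      poissonBracket J (poissonBracket J A B) D z
        + poissonBracket J (poissonBracket J D A) B z
        + poissonBracket J (poissonBracket J B D) A z = 0

/-- The Poisson bracket of `J` is generated on `U` by the Nambu bracket of `T` through the
observable `C`: `{A, B} = {A, B, C}` for all observables `A`, `B`. -/
def GeneratedBy {N : ℕ} (U : Set (Phase N)) (J : BiTensor N) (T : TriTensor N)
    (C : Phase N → ℝ) : Prop :=
  ∀ A B : Phase N → ℝ, IsObservable U A → IsObservable U B →
    ∀ z ∈ U, poissonBracket J A B z = nambuBracket T A B C z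

/-- A local change of coordinates `x = h(z)`: a smooth diffeomorphism between the open sets
`h.source` and `h.target`. -/
def IsCoordChange {N : ℕ} (h : OpenPartialHomeomorph (Phase N) (Phase N)) : Prop :=
  ContDiffOn ℝ ∞ h h.source ∧ ContDiffOn ℝ ∞ h.symm h.target

/-- The Nambu tensor in the new coordinates, `{h_i, h_j, h_k} ∘ h⁻¹`. -/
def pushNambu {N : ℕ} (h : OpenPartialHomeomorph (Phase N) (Phase N)) (T : TriTensor N) :
    TriTensor N :=
  fun x i j k => nambuBracket T (fun z => h z i) (fun z => h z j) (fun z => h z k) (h.symm x)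

/-- The Poisson tensor in the new coordinates, `{h_i, h_j} ∘ h⁻¹`. -/
def pushPoisson {N : ℕ} (h : OpenPartialHomeomorph (Phase N) (Phase N)) (J : BiTensor N) :
    BiTensor N :=
  fun x => Matrix.of fun i j => poissonBracket J (fun z => h z i) (fun z => h z j) (h.symm x)

/-- The Levi-Civita symbol on the indices `(1, 2, N)`, zero if another index occurs: the
determinant of the matrix of Kronecker deltas. Indices are numbered from `0` here. -/
def leviCivita (N : ℕ) (i j k : Fin N) : ℝ :=
  let row : Fin N → Fin 3 → ℝ := fun a =>
    ![if a.val = 0 then 1 else 0, if a.val = 1 then 1 else 0, if a.val + 1 = N then 1 else 0]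
  Matrix.det (Matrix.of ![row i, row j, row k])

/-- The canonical Poisson matrix with one pair of conjugate variables `(x_1, x_2)`, all other
entries being zero. Indices are numbered from `0` here. -/
def canonicalPoisson (N : ℕ) : Matrix (Fin N) (Fin N) ℝ :=
  Matrix.of fun i j =>
    if i.val = 0 ∧ j.val = 1 then 1 else if i.val = 1 ∧ j.val = 0 then -1 else 0

/-! ### Local equivalence classes -/

/-- A Nambu bracket near a point of `ℝ^N`, with a Nambu tensor that is nonzero at that point. -/
structure LocalNambu (N : ℕ) where
  dom : Set (Phase N)
  isOpen_dom : IsOpen dom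
  base : Phase N
  base_mem : base ∈ dom
  tensor : TriTensor N
  isNambu : IsNambuTensor dom tensor
  ne_zero : ∃ i j k, tensor base i j k ≠ 0

/-- A Poisson bracket near a point of `ℝ^N`, with a Poisson matrix of constant nonzero rank. -/
structure LocalPoisson (N : ℕ) where
  dom : Set (Phase N)
  isOpen_dom : IsOpen dom
  base : Phase N
  base_mem : base ∈ dom
  tensor : BiTensor N
  isPoisson : IsPoissonTensor dom tensor
  rank_const : ∃ r : ℕ, r ≠ 0 ∧ ∀ z ∈ dom, (tensor z).rank = r

/-- `h` is a change of coordinates from a neighbourhood of `p` inside `U` to a neighbourhood of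
`q` inside `V`, with `h p = q`. -/
structure IsCoordChangeBetween {N : ℕ} (U V : Set (Phase N)) (p q : Phase N)
    (h : OpenPartialHomeomorph (Phase N) (Phase N)) : Prop where
  coord : IsCoordChange h
  mem_source : p ∈ h.source
  source_subset : h.source ⊆ U
  target_subset : h.target ⊆ V
  map_base : h p = q

/-- Two local Nambu brackets are equivalent if some local change of coordinates around their
base points transforms one Nambu tensor into the other. -/
def NambuEquiv {N : ℕ} (a b : LocalNambu N) : Prop :=
  ∃ h : OpenPartialHomeomorph (Phase N) (Phase N),
    IsCoordChangeBetween a.dom b.dom a.base b.base h ∧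
      ∀ x ∈ h.target, ∀ i j k, pushNambu h a.tensor x i j k = b.tensor x i j k

/-- Two local Poisson brackets are equivalent if some local change of coordinates around their
base points transforms one Poisson tensor into the other. -/
def PoissonEquiv {N : ℕ} (a b : LocalPoisson N) : Prop :=
  ∃ h : OpenPartialHomeomorph (Phase N) (Phase N),
    IsCoordChangeBetween a.dom b.dom a.base b.base h ∧
      ∀ x ∈ h.target, ∀ i j, pushPoisson h a.tensor x i j = b.tensor x i j

/-- The Jacobian matrix `∂f_i/∂z_m`. -/
def jac {N : ℕ} (f : Phase N → Phase N) (z : Phase N) : Matrix (Fin N) (Fin N) ℝ :=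
  Matrix.of fun i m => pderiv m (fun w => f w i) z

theorem jac_eq {N : ℕ} {f : Phase N → Phase N} {z : Phase N} (hf : DifferentiableAt ℝ f z) :
    jac f z = LinearMap.toMatrix' (fderiv ℝ f z : Phase N →ₗ[ℝ] Phase N) := by
  ext i m
  rw [LinearMap.toMatrix'_apply]
  simp only [jac, pderiv, Matrix.of_apply]
  have h1 : (fun w => f w i) = fun w => (ContinuousLinearMap.proj (R := ℝ) i) (f w) := rfl
  have h2 : HasFDerivAt (fun w => f w i)
      ((ContinuousLinearMap.proj (R := ℝ) (φ := fun _ : Fin N => ℝ) i).comp (fderiv ℝ f z)) z :=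
    (ContinuousLinearMap.proj (R := ℝ) (φ := fun _ : Fin N => ℝ) i).hasFDerivAt.comp z
      hf.hasFDerivAt
  rw [h2.fderiv]
  rfl

theorem jac_comp {N : ℕ} {f g : Phase N → Phase N} {z : Phase N}
    (hg : DifferentiableAt ℝ g (f z)) (hf : DifferentiableAt ℝ f z) :
    jac (g ∘ f) z = jac g (f z) * jac f z := by
  rw [jac_eq (hg.comp z hf), jac_eq hg, jac_eq hf, fderiv_comp z hg hf,
    ← LinearMap.toMatrix'_comp]
  rfl

theorem jac_id {N : ℕ} {f : Phase N → Phase N} {z : Phase N} (hf : f =ᶠ[nhds z] id) :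
    jac f z = 1 := by
  have hd : DifferentiableAt ℝ f z := differentiableAt_id.congr_of_eventuallyEq hf
  rw [jac_eq hd, hf.fderiv_eq, fderiv_id]
  exact LinearMap.toMatrix'_id

/-- The action of a matrix on a trivalent tensor. -/
def act3 {N : ℕ} (M : Matrix (Fin N) (Fin N) ℝ) (t : Fin N → Fin N → Fin N → ℝ) :
    Fin N → Fin N → Fin N → ℝ :=
  fun i j k => ∑ m, ∑ n, ∑ p, t m n p * M i m * M j n * M k p

theorem act3_one {N : ℕ} (t : Fin N → Fin N → Fin N → ℝ) : act3 1 t = t := by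
  funext i j k
  simp [act3, Matrix.one_apply]

theorem act3_eq {N : ℕ} (M : Matrix (Fin N) (Fin N) ℝ) (t : Fin N → Fin N → Fin N → ℝ)
    (i j k : Fin N) :
    act3 M t i j k =
      (Matrix.kronecker M (Matrix.kronecker M M)).mulVec (fun x => t x.1 x.2.1 x.2.2)
        (i, j, k) := by
  simp only [act3, Matrix.mulVec, dotProduct, Fintype.sum_prod_type, Matrix.kronecker,
    Matrix.kroneckerMap_apply]
  refine Finset.sum_congr rfl fun m _ => Finset.sum_congr rfl fun n _ =>
    Finset.sum_congr rfl fun p _ => ?_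
  ring

theorem act3_mul {N : ℕ} (M M2 : Matrix (Fin N) (Fin N) ℝ) (t : Fin N → Fin N → Fin N → ℝ) :
    act3 (M * M2) t = act3 M (act3 M2 t) := by
  funext i j k
  rw [act3_eq, act3_eq]
  have h : (fun x : Fin N × Fin N × Fin N => act3 M2 t x.1 x.2.1 x.2.2) =
      (Matrix.kronecker M2 (Matrix.kronecker M2 M2)).mulVec
        (fun x => t x.1 x.2.1 x.2.2) := by
    funext x
    rw [act3_eq]
  rw [h, Matrix.mulVec_mulVec]
  simp only [Matrix.kronecker]
  rw [← Matrix.mul_kronecker_mul, ← Matrix.mul_kronecker_mul]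

theorem pushNambu_eq {N : ℕ} (h : OpenPartialHomeomorph (Phase N) (Phase N)) (T : TriTensor N)
    (x : Phase N) : pushNambu h T x = act3 (jac h (h.symm x)) (T (h.symm x)) := rfl

theorem pushPoisson_eq {N : ℕ} (h : OpenPartialHomeomorph (Phase N) (Phase N))
    (J : BiTensor N) (x : Phase N) :
    pushPoisson h J x = jac h (h.symm x) * J (h.symm x) * (jac h (h.symm x)).transpose := by
  ext i j
  simp only [pushPoisson, poissonBracket, Matrix.of_apply, Matrix.mul_apply,
    Matrix.transpose_apply, jac, Finset.sum_mul]
  rw [Finset.sum_comm]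
  refine Finset.sum_congr rfl fun m _ => Finset.sum_congr rfl fun n _ => ?_
  ring

theorem IsCoordChange.differentiableAt {N : ℕ}
    {h : OpenPartialHomeomorph (Phase N) (Phase N)} (hh : IsCoordChange h) {z : Phase N}
    (hz : z ∈ h.source) : DifferentiableAt ℝ h z :=
  (hh.1.contDiffAt (h.open_source.mem_nhds hz)).differentiableAt (by simp)

theorem IsCoordChange.symm {N : ℕ} {h : OpenPartialHomeomorph (Phase N) (Phase N)}
    (hh : IsCoordChange h) : IsCoordChange h.symm :=
  ⟨hh.2, hh.1⟩

theorem IsCoordChange.trans {N : ℕ} {h g : OpenPartialHomeomorph (Phase N) (Phase N)}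
    (hh : IsCoordChange h) (hg : IsCoordChange g) : IsCoordChange (h.trans g) := by
  constructor
  · rw [OpenPartialHomeomorph.coe_trans, OpenPartialHomeomorph.trans_source]
    exact hg.1.comp (hh.1.mono Set.inter_subset_left) fun z hz => hz.2
  · rw [OpenPartialHomeomorph.coe_trans_symm, OpenPartialHomeomorph.trans_target]
    exact hh.2.comp (hg.2.mono Set.inter_subset_left) fun z hz => hz.2

theorem jac_symm_mul {N : ℕ} {h : OpenPartialHomeomorph (Phase N) (Phase N)}
    (hh : IsCoordChange h) {z : Phase N} (hz : z ∈ h.source) :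
    jac h.symm (h z) * jac h z = 1 := by
  rw [← jac_comp (hh.symm.differentiableAt (h.map_source hz)) (hh.differentiableAt hz)]
  apply jac_id
  filter_upwards [h.open_source.mem_nhds hz] with w hw using h.left_inv hw

theorem IsCoordChangeBetween.refl {N : ℕ} {U : Set (Phase N)} (hU : IsOpen U) {p : Phase N}
    (hp : p ∈ U) : IsCoordChangeBetween U U p p (OpenPartialHomeomorph.ofSet U hU) :=
  ⟨⟨contDiffOn_id, contDiffOn_id⟩, hp, subset_rfl, subset_rfl, rfl⟩

theorem IsCoordChangeBetween.symm {N : ℕ} {U V : Set (Phase N)} {p q : Phase N}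
    {h : OpenPartialHomeomorph (Phase N) (Phase N)} (hh : IsCoordChangeBetween U V p q h) :
    IsCoordChangeBetween V U q p h.symm where
  coord := hh.coord.symm
  mem_source := hh.map_base ▸ h.map_source hh.mem_source
  source_subset := hh.target_subset
  target_subset := hh.source_subset
  map_base := by rw [← hh.map_base, h.left_inv hh.mem_source]

theorem IsCoordChangeBetween.trans {N : ℕ} {U V W : Set (Phase N)} {p q r : Phase N}
    {h g : OpenPartialHomeomorph (Phase N) (Phase N)} (hh : IsCoordChangeBetween U V p q h)
    (hg : IsCoordChangeBetween V W q r g) : IsCoordChangeBetween U W p r (h.trans g) where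
  coord := hh.coord.trans hg.coord
  mem_source := by
    rw [OpenPartialHomeomorph.trans_source]
    exact ⟨hh.mem_source, by rw [Set.mem_preimage, hh.map_base]; exact hg.mem_source⟩
  source_subset := by
    rw [OpenPartialHomeomorph.trans_source]
    exact fun z hz => hh.source_subset hz.1
  target_subset := by
    rw [OpenPartialHomeomorph.trans_target]
    exact fun z hz => hg.target_subset hz.1
  map_base := by
    rw [OpenPartialHomeomorph.coe_trans, Function.comp_apply, hh.map_base, hg.map_base]

theorem jac_ofSet {N : ℕ} {U : Set (Phase N)} (hU : IsOpen U) (z : Phase N) :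
    jac (OpenPartialHomeomorph.ofSet U hU) z = 1 :=
  jac_id (Filter.Eventually.of_forall fun _ => rfl)

theorem jac_trans {N : ℕ} {h g : OpenPartialHomeomorph (Phase N) (Phase N)}
    (hh : IsCoordChange h) (hg : IsCoordChange g) {x : Phase N} (hx : x ∈ (h.trans g).target) :
    jac (h.trans g) ((h.trans g).symm x) =
      jac g (g.symm x) * jac h (h.symm (g.symm x)) := by
  rw [OpenPartialHomeomorph.trans_target] at hx
  have h1 : h (h.symm (g.symm x)) = g.symm x := h.right_inv hx.2
  have h2 := jac_comp (f := h) (g := g) (z := h.symm (g.symm x))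
    (by rw [h1]; exact hg.differentiableAt (g.map_target hx.1))
    (hh.differentiableAt (h.map_target hx.2))
  rw [h1] at h2
  exact h2

theorem nambuEquiv_equivalence (N : ℕ) : Equivalence (NambuEquiv (N := N)) where
  refl a := by
    refine ⟨_, IsCoordChangeBetween.refl a.isOpen_dom a.base_mem, fun x _ i j k => ?_⟩
    rw [pushNambu_eq, jac_ofSet, act3_one]
    rfl
  symm := by
    rintro a b ⟨h, hh, hT⟩
    refine ⟨h.symm, hh.symm, fun z hz i j k => ?_⟩
    have hz1 : z ∈ h.source := hz
    have h1 : b.tensor (h z) = act3 (jac h z) (a.tensor z) := by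
      funext i j k
      rw [← hT (h z) (h.map_source hz1), pushNambu_eq, h.left_inv hz1]
    rw [pushNambu_eq, OpenPartialHomeomorph.symm_symm, h1, ← act3_mul,
      jac_symm_mul hh.coord hz1, act3_one]
  trans := by
    rintro a b c ⟨h, hh, hT⟩ ⟨g, hg, hS⟩
    refine ⟨h.trans g, hh.trans hg, fun x hx i j k => ?_⟩
    have hx1 := hx
    rw [OpenPartialHomeomorph.trans_target] at hx1
    have h1 : b.tensor (g.symm x) =
        act3 (jac h (h.symm (g.symm x))) (a.tensor (h.symm (g.symm x))) := by
      funext i j k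
      rw [← hT (g.symm x) hx1.2, pushNambu_eq]
    rw [pushNambu_eq, jac_trans hh.coord hg.coord hx, act3_mul, ← hS x hx1.1, pushNambu_eq, h1]
    rfl

theorem poissonEquiv_equivalence (N : ℕ) : Equivalence (PoissonEquiv (N := N)) where
  refl a := by
    refine ⟨_, IsCoordChangeBetween.refl a.isOpen_dom a.base_mem, fun x _ i j => ?_⟩
    rw [pushPoisson_eq, jac_ofSet, Matrix.transpose_one, one_mul, mul_one]
    rfl
  symm := by
    rintro a b ⟨h, hh, hT⟩
    refine ⟨h.symm, hh.symm, fun z hz i j => ?_⟩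
    have hz1 : z ∈ h.source := hz
    have h1 : b.tensor (h z) = jac h z * a.tensor z * (jac h z).transpose := by
      ext i j
      rw [← hT (h z) (h.map_source hz1), pushPoisson_eq, h.left_inv hz1]
    have h2 := jac_symm_mul hh.coord hz1
    have h3 : (jac h z).transpose * (jac h.symm (h z)).transpose = 1 := by
      rw [← Matrix.transpose_mul, h2, Matrix.transpose_one]
    rw [pushPoisson_eq, OpenPartialHomeomorph.symm_symm, h1]
    have h4 : jac h.symm (h z) * (jac h z * a.tensor z * (jac h z).transpose) *
        (jac h.symm (h z)).transpose = (jac h.symm (h z) * jac h z) * a.tensor z *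
        ((jac h z).transpose * (jac h.symm (h z)).transpose) := by
      simp only [Matrix.mul_assoc]
    rw [h4, h2, h3, one_mul, mul_one]
  trans := by
    rintro a b c ⟨h, hh, hT⟩ ⟨g, hg, hS⟩
    refine ⟨h.trans g, hh.trans hg, fun x hx i j => ?_⟩
    have hx1 := hx
    rw [OpenPartialHomeomorph.trans_target] at hx1
    have h1 : b.tensor (g.symm x) = jac h (h.symm (g.symm x)) *
        a.tensor (h.symm (g.symm x)) * (jac h (h.symm (g.symm x))).transpose := by
      ext i j
      rw [← hT (g.symm x) hx1.2, pushPoisson_eq]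
    rw [← hS x hx1.1, pushPoisson_eq, pushPoisson_eq, jac_trans hh.coord hg.coord hx, h1,
      Matrix.transpose_mul]
    simp only [Matrix.mul_assoc]
    rfl

/-- Local Nambu brackets up to local changes of coordinates. -/
def NambuClass (N : ℕ) : Type :=
  Quotient (Setoid.mk (NambuEquiv (N := N)) (nambuEquiv_equivalence N))

/-- Local Poisson brackets of constant nonzero rank up to local changes of coordinates. -/
def PoissonClass (N : ℕ) : Type :=
  Quotient (Setoid.mk (PoissonEquiv (N := N)) (poissonEquiv_equivalence N))

end NambuLocal

end

/-! Everything rests on one analytic fact: finitely many commuting vector fields that are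
independent at a point become constant under a local diffeomorphism (`exists_straighten`). Functions
whose mutual brackets are constant have commuting Hamiltonian fields, by the Jacobi identity in the
Poisson case and by the fundamental identity in the Nambu case (`lieBracket_poissonField`,
`lieBracket_nambuField`). Straightening these fields supplies the missing coordinates as joint first
integrals (`exists_coordinates`).

Let a Nambu tensor be nonzero at p. There are functions B, C whose field X_{B,C} does not vanish at
p, and straightening this field gives A with {A,B,C} = 1 near p. The fields X_{B,C}, X_{C,A},
X_{A,B} commute and are dual to A, B, C, so these three functions are completed to coordinates by
first integrals. The other components of the tensor vanish for an algebraic reason: the fundamental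
identity contains a condition quadratic in the tensor (`triForm_quad`), which makes it decomposable
at each point. Hence there is a single class. If a Poisson bracket of rank two is generated through
C, then C can be one of the three functions; placed in the last slot, it makes the Poisson matrix
the contraction of the Levi-Civita symbol with the index N.

For Poisson tensors of constant rank this is Darboux's theorem, by splitting off conjugate pairs one
at a time (`exists_isPartialDarboux_succ`) until all remaining brackets vanish at p; constancy of
the rank then makes them vanish near p (`eq_sympMatrix_of_rank_eq`). The rank 2n is invariant under
coordinate changes, so the classes correspond to 1 ≤ n ≤ N / 2.

Straightening needs flows that are smooth jointly in time and starting point. These come from the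
inverse function theorem in a Banach space of curves (`exists_flow`). -/

noncomputable section

namespace NambuLocal

universe u

open Filter Topology

/-! ### Germs of smooth maps and the inverse function theorem. -/

section Germs

variable {E F G : Type*} [NormedAddCommGroup E] [NormedSpace ℝ E]
  [NormedAddCommGroup F] [NormedSpace ℝ F] [NormedAddCommGroup G] [NormedSpace ℝ G]

/-- `f` is smooth on some neighbourhood of `p`. -/
def SmoothNear (f : E → F) (p : E) : Prop := ∀ᶠ z in 𝓝 p, ContDiffAt ℝ ∞ f z

theorem SmoothNear.self {f : E → F} {p : E} (h : SmoothNear f p) : ContDiffAt ℝ ∞ f p :=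
  h.self_of_nhds

theorem SmoothNear.eventually {f : E → F} {p : E} (h : SmoothNear f p) :
    ∀ᶠ z in 𝓝 p, SmoothNear f z :=
  eventually_eventually_nhds.2 h

theorem SmoothNear.differentiableAt {f : E → F} {p : E} (h : SmoothNear f p) :
    DifferentiableAt ℝ f p :=
  h.self.differentiableAt (by simp)

theorem SmoothNear.continuousAt {f : E → F} {p : E} (h : SmoothNear f p) :
    ContinuousAt f p :=
  h.self.continuousAt

theorem SmoothNear.of_contDiff {f : E → F} (h : ContDiff ℝ ∞ f) (p : E) : SmoothNear f p :=
  Eventually.of_forall fun _ => h.contDiffAt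

theorem SmoothNear.of_contDiffOn {f : E → F} {U : Set E} {p : E} (h : ContDiffOn ℝ ∞ f U)
    (hU : IsOpen U) (hp : p ∈ U) : SmoothNear f p := by
  filter_upwards [hU.mem_nhds hp] with z hz using h.contDiffAt (hU.mem_nhds hz)

theorem SmoothNear.comp {g : F → G} {f : E → F} {p : E} (hg : SmoothNear g (f p))
    (hf : SmoothNear f p) : SmoothNear (fun z => g (f z)) p := by
  filter_upwards [hf, hf.continuousAt.eventually hg] with z h1 h2 using h2.comp z h1

theorem SmoothNear.fderiv {f : E → F} {p : E} (hf : SmoothNear f p) :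
    SmoothNear (fun z => _root_.fderiv ℝ f z) p := by
  filter_upwards [hf] with z hz using hz.fderiv_right (by simp)

theorem SmoothNear.clm_apply {f : E → F →L[ℝ] G} {g : E → F} {p : E} (hf : SmoothNear f p)
    (hg : SmoothNear g p) : SmoothNear (fun z => f z (g z)) p := by
  filter_upwards [hf, hg] with z h1 h2 using h1.clm_apply h2

theorem SmoothNear.sub {f g : E → F} {p : E} (hf : SmoothNear f p) (hg : SmoothNear g p) :
    SmoothNear (fun z => f z - g z) p := by
  filter_upwards [hf, hg] with z h1 h2 using h1.sub h2

theorem SmoothNear.mul {f g : E → ℝ} {p : E} (hf : SmoothNear f p) (hg : SmoothNear g p) :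
    SmoothNear (fun z => f z * g z) p := by
  filter_upwards [hf, hg] with z h1 h2 using h1.mul h2

theorem SmoothNear.const (c : F) (p : E) : SmoothNear (fun _ => c) p :=
  Eventually.of_forall fun _ => contDiffAt_const

theorem SmoothNear.sum {ι : Type*} {s : Finset ι} {f : ι → E → F} {p : E}
    (hf : ∀ i ∈ s, SmoothNear (f i) p) : SmoothNear (fun z => ∑ i ∈ s, f i z) p := by
  filter_upwards [(s.eventually_all).2 hf] with z h using ContDiffAt.sum h

theorem SmoothNear.pi {ι : Type*} [Fintype ι] {f : E → ι → ℝ} {p : E}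
    (hf : ∀ i, SmoothNear (fun z => f z i) p) : SmoothNear f p := by
  filter_upwards [eventually_all.2 hf] with z h using contDiffAt_pi.2 h

/-- A function smooth near `p` agrees near `p` with a smooth function on the whole space. -/
theorem SmoothNear.exists_contDiff [FiniteDimensional ℝ E] {f : E → F} {p : E}
    (hf : SmoothNear f p) : ∃ g : E → F, ContDiff ℝ ∞ g ∧ g =ᶠ[𝓝 p] f := by
  obtain ⟨U, hU, hUo, hpU⟩ := eventually_nhds_iff.1 hf
  obtain ⟨r, hr, hrU⟩ := Metric.isOpen_iff.1 hUo p hpU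
  -- The outer radius is below r, so the closed support of the bump lies inside the ball where f is
  -- smooth.
  let b : ContDiffBump p := ⟨r / 3, r / 2, by positivity, by linarith⟩
  refine ⟨fun z => b z • f z, ?_, ?_⟩
  · rw [contDiff_iff_contDiffAt]
    intro z
    by_cases hz : z ∈ Metric.ball p r
    · exact b.contDiff.contDiffAt.smul (hU z (hrU hz))
    · have h1 : z ∈ (tsupport b)ᶜ := by
        rw [b.tsupport_eq, Set.mem_compl_iff, Metric.mem_closedBall, not_le]
        rw [Metric.mem_ball, not_lt] at hz
        change r / 2 < _
        linarith
      have h2 : (fun z => b z • f z) =ᶠ[𝓝 z] fun _ => 0 := by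
        filter_upwards [(isClosed_tsupport b).isOpen_compl.mem_nhds h1] with w hw
        rw [image_eq_zero_of_notMem_tsupport hw, zero_smul]
      exact contDiffAt_const.congr_of_eventuallyEq h2
  · filter_upwards [b.eventuallyEq_one] with z hz
    simp [hz]

/-- The inverse function theorem for maps smooth near a point. -/
theorem SmoothNear.exists_openPartialHomeomorph [CompleteSpace E] {f : E → F} {a : E}
    (hf : SmoothNear f a) (e : E ≃L[ℝ] F) (he : _root_.fderiv ℝ f a = e) {U : Set E}
    (hU : U ∈ 𝓝 a) :
    ∃ h : OpenPartialHomeomorph E F, ⇑h = f ∧ a ∈ h.source ∧ h.source ⊆ U ∧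
      ContDiffOn ℝ ∞ h h.source ∧ ContDiffOn ℝ ∞ h.symm h.target := by
  have hd : HasFDerivAt f (e : E →L[ℝ] F) a := he ▸ hf.differentiableAt.hasFDerivAt
  let h0 := hf.self.toOpenPartialHomeomorph f hd (by simp)
  have h0f : ⇑h0 = f := hf.self.toOpenPartialHomeomorph_coe hd (by simp)
  have h0a : a ∈ h0.source := hf.self.mem_toOpenPartialHomeomorph_source hd (by simp)
  -- Invertibility of the derivative is an open condition. Restricting to where it holds makes the
  -- inverse smooth on the whole target, not just at the image of a.
  have hinv : ∀ᶠ z in 𝓝 a, ∃ e' : E ≃L[ℝ] F, (e' : E →L[ℝ] F) = _root_.fderiv ℝ f z := by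
    have := hf.fderiv.continuousAt
    exact this.eventually (he ▸ e.nhds)
  obtain ⟨V, hV, hVo, haV⟩ := eventually_nhds_iff.1 ((hf.and hinv).and (eventually_mem_set.2 hU))
  refine ⟨h0.restrOpen V hVo, h0f, ⟨h0a, haV⟩, fun z hz => (hV z hz.2).2, ?_, ?_⟩
  · intro z hz
    have : ContDiffAt ℝ ∞ f z := (hV z hz.2).1.1
    rw [← h0f] at this
    exact this.contDiffWithinAt
  · intro y hy
    have hz : (h0.restrOpen V hVo).symm y ∈ V := ((h0.restrOpen V hVo).map_target hy).2
    obtain ⟨⟨h1, e', h2⟩, -⟩ := hV _ hz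
    refine ((h0.restrOpen V hVo).contDiffAt_symm (f₀' := e') hy ?_ ?_).contDiffWithinAt
    · rw [h2]
      have := (h1.differentiableAt (by simp)).hasFDerivAt
      change HasFDerivAt (⇑h0) _ _
      rw [h0f]
      exact this
    · change ContDiffAt ℝ ∞ (⇑h0) _
      rw [h0f]
      exact h1

end Germs

/-! ### Smoothness of composition operators on spaces of continuous maps. -/

section Omega

variable {K : Type*} [TopologicalSpace K] [CompactSpace K]

/-- A continuous family of linear maps acts on continuous functions. -/
def pointwiseApply (K : Type*) [TopologicalSpace K] [CompactSpace K] (E F : Type*)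
    [NormedAddCommGroup E] [NormedSpace ℝ E] [NormedAddCommGroup F] [NormedSpace ℝ F] :
    C(K, E →L[ℝ] F) →L[ℝ] C(K, E) →L[ℝ] C(K, F) :=
  LinearMap.mkContinuous₂
    (LinearMap.mk₂ ℝ
      (fun (A : C(K, E →L[ℝ] F)) (h : C(K, E)) =>
        (⟨fun t => A t (h t), by fun_prop⟩ : C(K, F)))
      (fun _ _ _ => by ext; simp) (fun _ _ _ => by ext; simp)
      (fun _ _ _ => by ext; simp) (fun _ _ _ => by ext; simp))
    1 (fun A h => by
      rw [ContinuousMap.norm_le _ (by positivity)]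
      intro t
      rw [one_mul]
      exact ((A t).le_opNorm _).trans (mul_le_mul (A.norm_coe_le_norm t) (h.norm_coe_le_norm t)
        (norm_nonneg _) (by positivity)))

/-- The mean value inequality on the segment from γ t to γ t + h t bounds the error at t. The bound
is uniform in t because postcomposition with f' is continuous for the sup norm. -/
theorem hasFDerivAt_postcomp {E F : Type*}
    [NormedAddCommGroup E] [NormedSpace ℝ E] [NormedAddCommGroup F] [NormedSpace ℝ F]
    (f : C(E, F)) (f' : C(E, E →L[ℝ] F)) (hf : ∀ x, HasFDerivAt f (f' x) x) (γ : C(K, E)) :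
    HasFDerivAt (fun γ : C(K, E) => f.comp γ) (pointwiseApply K E F (f'.comp γ)) γ := by
  rw [hasFDerivAt_iff_isLittleO_nhds_zero, Asymptotics.isLittleO_iff]
  intro c hc
  have hcont : ContinuousAt (fun η : C(K, E) => f'.comp η) γ :=
    (ContinuousMap.continuous_postcomp f').continuousAt
  obtain ⟨δ, hδ, hball⟩ := (Metric.continuousAt_iff (f := fun η : C(K, E) => f'.comp η) (a := γ)).1
    hcont c hc
  filter_upwards [Metric.ball_mem_nhds (0 : C(K, E)) hδ] with h hh
  rw [mem_ball_zero_iff] at hh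
  rw [ContinuousMap.norm_le _ (by positivity)]
  intro t
  have h1 : ‖f (γ t + h t) - f (γ t) - f' (γ t) (γ t + h t - γ t)‖ ≤ c * ‖γ t + h t - γ t‖ := by
    refine Convex.norm_image_sub_le_of_norm_hasFDerivWithin_le' (s := segment ℝ (γ t) (γ t + h t))
      (fun x _ => (hf x).hasFDerivWithinAt) ?_ (convex_segment _ _) (left_mem_segment _ _ _)
      (right_mem_segment _ _ _)
    rintro x hx
    rw [segment_eq_image'] at hx
    obtain ⟨s, hs, rfl⟩ := hx
    -- A point of the segment is the value at t of the curve γ + s • h, which is within δ of γ.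
    have h2 : dist (γ + s • h) γ < δ := by
      rw [dist_eq_norm, add_sub_cancel_left, norm_smul, Real.norm_of_nonneg hs.1]
      exact (mul_le_of_le_one_left (norm_nonneg _) hs.2).trans_lt hh
    have h3 := (ContinuousMap.dist_apply_le_dist t).trans (hball h2).le
    rw [dist_eq_norm] at h3
    simpa using h3
  rw [add_sub_cancel_left] at h1
  exact h1.trans (mul_le_mul_of_nonneg_left (h.norm_coe_le_norm t) hc.le)

/-- The derivative of postcomposition with f is, up to a fixed bounded linear map, postcomposition
with f'. Hence the induction lets F vary, and E and F share a universe so that E →L[ℝ] F is again an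
admissible target. -/
theorem contDiff_postcomp_nat {K : Type*} [TopologicalSpace K] [CompactSpace K]
    {E : Type u} [NormedAddCommGroup E] [NormedSpace ℝ E] (n : ℕ) :
    ∀ {F : Type u} [NormedAddCommGroup F] [NormedSpace ℝ F] (f : C(E, F)),
      ContDiff ℝ ∞ f → ContDiff ℝ n (fun γ : C(K, E) => f.comp γ) := by
  induction n with
  | zero =>
    intro F _ _ f _
    exact contDiff_zero.2 (ContinuousMap.continuous_postcomp f)
  | succ n ih =>
    intro F _ _ f hf
    have hf' : ContDiff ℝ ∞ (fderiv ℝ f) := hf.fderiv_right (by simp)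
    let f' : C(E, E →L[ℝ] F) := ⟨fderiv ℝ f, hf'.continuous⟩
    rw [Nat.cast_add, Nat.cast_one]
    refine contDiff_succ_iff_hasFDerivAt.2
      ⟨fun γ => pointwiseApply K E F (f'.comp γ), ?_, fun γ => ?_⟩
    · exact (pointwiseApply K E F).contDiff.comp (ih f' hf')
    · exact hasFDerivAt_postcomp f f'
        (fun x => ((hf.differentiable (by simp)) x).hasFDerivAt) γ

/-- Composition with a smooth function is smooth on the space of continuous functions. -/
theorem contDiff_postcomp {E F : Type u} [NormedAddCommGroup E] [NormedSpace ℝ E]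
    [NormedAddCommGroup F] [NormedSpace ℝ F] (f : C(E, F)) (hf : ContDiff ℝ ∞ f) :
    ContDiff ℝ ∞ (fun γ : C(K, E) => f.comp γ) :=
  contDiff_infty.2 fun n => contDiff_postcomp_nat n f hf

end Omega

/-! ### Smooth local flows from the inverse function theorem. -/

section Flow

/-- The interval on which rescaled integral curves are defined. -/
abbrev UnitInterval : Type := Set.Icc (-1 : ℝ) 1

/-- The retraction of the real line onto the interval. -/
def toUnit (s : ℝ) : UnitInterval := Set.projIcc (-1 : ℝ) 1 (by norm_num) s

theorem continuous_toUnit : Continuous toUnit :=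
  continuous_projIcc (h := by norm_num)

theorem coe_toUnit {s : ℝ} (h : |s| ≤ 1) : (toUnit s : ℝ) = s := by
  rw [toUnit, Set.projIcc_of_mem _ (abs_le.1 h)]

theorem abs_coe_le (s : UnitInterval) : |(s : ℝ)| ≤ 1 := abs_le.2 s.2

variable (E : Type u) [NormedAddCommGroup E] [NormedSpace ℝ E]

/-- Constant curves. -/
def constCurve : E →L[ℝ] C(UnitInterval, E) :=
  LinearMap.mkContinuous
    { toFun := fun z => ContinuousMap.const _ z
      map_add' := fun _ _ => rfl
      map_smul' := fun _ _ => rfl } 1 (fun z => by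
        rw [ContinuousMap.norm_le _ (by positivity)]
        intro t
        exact (one_mul ‖z‖).ge)

/-- The primitive of a curve vanishing at `0`. -/
def primitive : C(UnitInterval, E) →L[ℝ] C(UnitInterval, E) :=
  LinearMap.mkContinuous
    { toFun := fun γ => ⟨fun t => ∫ s in (0 : ℝ)..t, γ (toUnit s),
        (intervalIntegral.continuous_primitive (fun a b =>
          (γ.continuous.comp continuous_toUnit).intervalIntegrable a b) 0).comp
          continuous_subtype_val⟩
      map_add' := fun γ η => by
        ext t
        exact intervalIntegral.integral_add
          ((γ.continuous.comp continuous_toUnit).intervalIntegrable _ _)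
          ((η.continuous.comp continuous_toUnit).intervalIntegrable _ _)
      map_smul' := fun c γ => by
        ext t
        exact intervalIntegral.integral_smul c _ } 1 (fun γ => by
        rw [ContinuousMap.norm_le _ (by positivity)]
        intro t
        refine (intervalIntegral.norm_integral_le_of_norm_le_const
          (fun s _ => γ.norm_coe_le_norm (toUnit s))).trans ?_
        rw [sub_zero, mul_comm]
        exact mul_le_mul_of_nonneg_right (abs_coe_le t) (norm_nonneg _))

variable {E}

theorem primitive_apply (γ : C(UnitInterval, E)) (t : UnitInterval) :
    primitive E γ t = ∫ s in (0 : ℝ)..t, γ (toUnit s) := rfl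

/-- The shear of a product along a linear map. -/
def shear {B W : Type*} [NormedAddCommGroup B] [NormedSpace ℝ B] [NormedAddCommGroup W]
    [NormedSpace ℝ W] (l : B →L[ℝ] W) : (B × W) ≃L[ℝ] (B × W) :=
  ContinuousLinearEquiv.equivOfInverse
    ((ContinuousLinearMap.fst ℝ B W).prod
      (ContinuousLinearMap.snd ℝ B W - l.comp (ContinuousLinearMap.fst ℝ B W)))
    ((ContinuousLinearMap.fst ℝ B W).prod
      (ContinuousLinearMap.snd ℝ B W + l.comp (ContinuousLinearMap.fst ℝ B W)))
    (fun x => by simp) (fun x => by simp)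

/-- The defect of a curve as a rescaled integral curve of `X` with a given starting point. -/
def flowDefect (X : C(E, E)) (x : (ℝ × E) × C(UnitInterval, E)) :
    (ℝ × E) × C(UnitInterval, E) :=
  (x.1, x.2 - constCurve E x.1.2 - x.1.1 • primitive E (X.comp x.2))

theorem contDiff_flowDefect (X : C(E, E)) (hX : ContDiff ℝ ∞ X) :
    ContDiff ℝ ∞ (flowDefect X) := by
  have h1 : ContDiff ℝ ∞ fun x : (ℝ × E) × C(UnitInterval, E) => X.comp x.2 :=
    (contDiff_postcomp X hX).comp contDiff_snd
  unfold flowDefect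
  have h2 : ContDiff ℝ ∞ fun x : (ℝ × E) × C(UnitInterval, E) => constCurve E x.1.2 :=
    (constCurve E).contDiff.comp (contDiff_snd.comp contDiff_fst)
  have h3 : ContDiff ℝ ∞ fun x : (ℝ × E) × C(UnitInterval, E) => primitive E (X.comp x.2) :=
    (primitive E).contDiff.comp h1
  have h4 : ContDiff ℝ ∞ fun x : (ℝ × E) × C(UnitInterval, E) => x.1.1 :=
    contDiff_fst.comp contDiff_fst
  exact contDiff_fst.prodMk ((contDiff_snd.sub h2).sub (h4.smul h3))

/-- At time 0 the nonlinear term carries the factor 0, so the derivative of X does not enter. What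
is left is the identity on curves plus a term depending on (t, z) only: a shear, hence invertible.
-/
theorem fderiv_flowDefect (X : C(E, E)) (hX : ContDiff ℝ ∞ X) (p : E) :
    fderiv ℝ (flowDefect X) ((0, p), constCurve E p) =
      (shear ((constCurve E).comp (ContinuousLinearMap.snd ℝ ℝ E) +
        (ContinuousLinearMap.fst ℝ ℝ E).smulRight (primitive E (X.comp (constCurve E p)))) :
        _ →L[ℝ] _) := by
  apply HasFDerivAt.fderiv
  let x₀ : (ℝ × E) × C(UnitInterval, E) := ((0, p), constCurve E p)
  have h1 : ContDiff ℝ ∞ fun x : (ℝ × E) × C(UnitInterval, E) => primitive E (X.comp x.2) :=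
    (primitive E).contDiff.comp ((contDiff_postcomp X hX).comp contDiff_snd)
  have h2 := ((h1.differentiable (by simp)) x₀).hasFDerivAt
  have h3 : HasFDerivAt (fun x : (ℝ × E) × C(UnitInterval, E) => x.1.1)
      ((ContinuousLinearMap.fst ℝ ℝ E).comp (ContinuousLinearMap.fst ℝ _ _)) x₀ :=
    HasFDerivAt.comp x₀ hasFDerivAt_fst hasFDerivAt_fst
  have h4 : HasFDerivAt (fun x : (ℝ × E) × C(UnitInterval, E) => constCurve E x.1.2)
      ((constCurve E).comp
        ((ContinuousLinearMap.snd ℝ ℝ E).comp (ContinuousLinearMap.fst ℝ _ _))) x₀ :=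
    (constCurve E).hasFDerivAt.comp x₀ (HasFDerivAt.comp x₀ hasFDerivAt_snd hasFDerivAt_fst)
  refine (hasFDerivAt_fst.prodMk ((hasFDerivAt_snd.sub h4).sub (h3.smul h2))).congr_fderiv ?_
  refine ContinuousLinearMap.ext fun v => ?_
  simp [shear, x₀, sub_sub]

/-- A smooth vector field has a local flow that depends smoothly on time and starting point. -/
theorem exists_flow [CompleteSpace E] {X : E → E} (hX : ContDiff ℝ ∞ X) (p : E) :
    ∃ Φ : ℝ × E → E, SmoothNear Φ (0, p) ∧ ∀ᶠ q : ℝ × E in 𝓝 (0, p), Φ (0, q.2) = q.2 ∧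
      HasDerivAt (fun t => Φ (t, q.2)) (X (Φ q)) q.1 := by
  let Xc : C(E, E) := ⟨X, hX.continuous⟩
  let W := C(UnitInterval, E)
  let x₀ : (ℝ × E) × W := ((0, p), constCurve E p)
  obtain ⟨h, hG, hx₀, -, -, hsymm⟩ := (SmoothNear.of_contDiff (contDiff_flowDefect Xc hX)
    x₀).exists_openPartialHomeomorph _ (fderiv_flowDefect Xc hX p) univ_mem
  have hGx₀ : h x₀ = ((0, p), 0) := by
    rw [hG]
    simp [flowDefect, x₀]
  have ht₀ : ((0, p), (0 : W)) ∈ h.target := hGx₀ ▸ h.map_source hx₀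
  -- A zero of the defect over (t, z) is a curve γ on [-1, 1] with γ' = t X(γ) and γ(0) = z; the
  -- flow will be its value at 1.
  let sol : ℝ × E → W := fun q => (h.symm (q, 0)).2
  have hsol : SmoothNear sol (0, p) := by
    have h1 : SmoothNear h.symm ((0, p), (0 : W)) :=
      SmoothNear.of_contDiffOn hsymm h.open_target ht₀
    have h2 : ContDiff ℝ ∞ fun q : ℝ × E => (q, (0 : W)) := contDiff_id.prodMk contDiff_const
    have h3 := SmoothNear.comp (f := fun q : ℝ × E => (q, (0 : W))) h1
      (SmoothNear.of_contDiff h2 (0, p))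
    exact SmoothNear.comp (g := Prod.snd) (.of_contDiff contDiff_snd _) h3
  have hsol₀ : sol (0, p) = constCurve E p := by
    change (h.symm ((0, p), 0)).2 = _
    rw [← hGx₀, h.left_inv hx₀]
  have htarget : ∀ᶠ q : ℝ × E in 𝓝 (0, p), (q, (0 : W)) ∈ h.target := by
    have : ContinuousAt (fun q : ℝ × E => (q, (0 : W))) (0, p) := by fun_prop
    exact this.eventually (h.open_target.mem_nhds ht₀)
  have hsol_eq : ∀ q : ℝ × E, (q, (0 : W)) ∈ h.target → h.symm (q, 0) = (q, sol q) ∧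
      sol q = constCurve E q.2 + q.1 • primitive E (Xc.comp (sol q)) := by
    intro q hq
    have h1 := h.right_inv hq
    rw [hG] at h1
    have h2 : (h.symm (q, 0)).1 = q := congrArg Prod.fst h1
    have h3 : h.symm (q, 0) = (q, sol q) := Prod.ext h2 rfl
    refine ⟨h3, ?_⟩
    rw [h3] at h1
    have h4 : sol q - constCurve E q.2 - q.1 • primitive E (Xc.comp (sol q)) = 0 :=
      congrArg Prod.snd h1
    rw [sub_sub, sub_eq_zero] at h4
    exact h4
  obtain ⟨δ, hδ, hball⟩ := Metric.isOpen_iff.1 h.open_source x₀ hx₀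
  have hclose : ∀ᶠ q : ℝ × E in 𝓝 (0, p), dist (sol q) (constCurve E p) < δ := by
    have := hsol.continuousAt
    rw [ContinuousAt, hsol₀] at this
    exact this.eventually (Metric.ball_mem_nhds _ hδ)
  obtain ⟨r, hr, hrq⟩ := Metric.eventually_nhds_iff_ball.1 ((htarget.and hclose).and
    (Metric.ball_mem_nhds ((0 : ℝ), p) hδ))
  set ε : ℝ := r / 2 with hε
  have hε0 : 0 < ε := by positivity
  have hmem : ∀ t : ℝ, ∀ z : E, |t| ≤ ε → dist z p < r → (t, z) ∈ Metric.ball ((0 : ℝ), p) r := by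
    intro t z ht hz
    rw [Metric.mem_ball, Prod.dist_eq, max_lt_iff]
    refine ⟨?_, hz⟩
    rw [Real.dist_eq, sub_zero]
    linarith
  -- All curves from z are reparametrisations of the one for time ε. This turns the dependence on t
  -- into dependence on the curve variable, where the integral equation can be differentiated.
  have hval : ∀ t : ℝ, ∀ z : E, |t| ≤ ε → dist z p < r →
      sol (t, z) (toUnit 1) = sol (ε, z) (toUnit (t / ε)) := by
    intro t z ht hz
    have hm := hrq _ (hmem t z ht hz)
    have hmε := hrq _ (hmem ε z (abs_of_pos hε0).le hz)
    obtain ⟨e1, e2⟩ := hsol_eq _ hm.1.1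
    obtain ⟨-, e4⟩ := hsol_eq _ hmε.1.1
    have hs : |t / ε| ≤ 1 := by
      rw [abs_div, abs_of_pos hε0]
      exact (div_le_one hε0).2 ht
    set s := t / ε with hsdef
    have hsu : ∀ u : ℝ, |u| ≤ 1 → |s * u| ≤ 1 := fun u hu => by
      rw [abs_mul]
      exact mul_le_one₀ hs (abs_nonneg _) hu
    -- The curve for time ε, slowed down by s = t / ε, is also a zero of the defect over (t, z).
    -- Both zeros lie in the domain on which the defect map is injective, so they coincide.
    let η : W := ⟨fun u => sol (ε, z) (toUnit (s * u)),
      (sol (ε, z)).continuous.comp (continuous_toUnit.comp (by fun_prop))⟩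
    have hη : h ((t, z), η) = ((t, z), 0) := by
      rw [hG]
      refine Prod.ext rfl ?_
      change η - constCurve E z - t • primitive E (Xc.comp η) = 0
      rw [sub_sub, sub_eq_zero]
      ext u
      change sol (ε, z) (toUnit (s * u)) = z + t • primitive E (Xc.comp η) u
      have e5 := DFunLike.congr_fun e4 (toUnit (s * u))
      have e6 : (constCurve E (ε, z).2 + (ε, z).1 • primitive E (Xc.comp (sol (ε, z))))
          (toUnit (s * u)) =
          z + ε • ∫ v in (0 : ℝ)..(toUnit (s * u)), X (sol (ε, z) (toUnit v)) := rfl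
      rw [e5, e6, coe_toUnit (hsu u (abs_coe_le u)), primitive_apply]
      congr 1
      have e7 : (∫ v in (0 : ℝ)..(s * u), X (sol (ε, z) (toUnit v))) =
          s • ∫ v in (0 : ℝ)..u, X (sol (ε, z) (toUnit (s * v))) := by
        have := intervalIntegral.smul_integral_comp_mul_left
          (fun v => X (sol (ε, z) (toUnit v))) s (a := 0) (b := (u : ℝ))
        rw [this, mul_zero]
      rw [e7, smul_smul, hsdef, mul_div_cancel₀ _ hε0.ne', ← hsdef]
      congr 1
      refine intervalIntegral.integral_congr fun v hv => ?_
      have hv1 : |v| ≤ 1 := by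
        have h1 := abs_le.1 (abs_coe_le u)
        rw [Set.mem_uIcc] at hv
        rw [abs_le]
        constructor <;> rcases hv with hv | hv <;> linarith [hv.1, hv.2]
      change X (sol (ε, z) (toUnit (s * v))) = X (sol (ε, z) (toUnit (s * toUnit v)))
      rw [coe_toUnit hv1]
    have hηδ : dist η (constCurve E p) < δ := by
      rw [ContinuousMap.dist_lt_iff hδ]
      intro u
      exact (ContinuousMap.dist_apply_le_dist (f := sol (ε, z)) (g := constCurve E p)
        (toUnit (s * u))).trans_lt hmε.1.2
    have hin : ∀ ζ : W, dist ζ (constCurve E p) < δ → ((t, z), ζ) ∈ h.source := by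
      intro ζ hζ
      refine hball ?_
      rw [Metric.mem_ball, Prod.dist_eq, max_lt_iff]
      exact ⟨Metric.mem_ball.1 hm.2, hζ⟩
    have hsols : h ((t, z), sol (t, z)) = ((t, z), 0) := by
      rw [← e1, h.right_inv hm.1.1]
    have := h.injOn (hin _ hm.1.2) (hin _ hηδ) (hsols.trans hη.symm)
    have e8 : sol (t, z) = η := congrArg Prod.snd this
    rw [e8]
    change sol (ε, z) (toUnit (s * toUnit 1)) = _
    rw [coe_toUnit (by simp), mul_one]
  refine ⟨fun q => sol q (toUnit 1), ?_, ?_⟩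
  · have h1 : ContDiff ℝ ∞ fun γ : W => γ (toUnit 1) :=
      (ContinuousMap.evalCLM ℝ (toUnit 1) : C(UnitInterval, E) →L[ℝ] E).contDiff
    exact SmoothNear.comp (g := fun γ : W => γ (toUnit 1)) (.of_contDiff h1 _) hsol
  · filter_upwards [Metric.ball_mem_nhds ((0 : ℝ), p) hε0] with q hq
    obtain ⟨t, z⟩ := q
    rw [Metric.mem_ball, Prod.dist_eq, max_lt_iff, Real.dist_eq, sub_zero] at hq
    obtain ⟨ht, hz⟩ := hq
    change |t| < ε at ht
    change dist z p < ε at hz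
    have hz' : dist z p < r := by linarith
    obtain ⟨-, e4⟩ := hsol_eq _ (hrq _ (hmem ε z (abs_of_pos hε0).le hz')).1.1
    have hform : ∀ t' : ℝ, |t'| ≤ ε → sol (t', z) (toUnit 1) =
        z + ε • ∫ v in (0 : ℝ)..(t' / ε), X (sol (ε, z) (toUnit v)) := by
      intro t' ht'
      have hs : |t' / ε| ≤ 1 := by
        rw [abs_div, abs_of_pos hε0]
        exact (div_le_one hε0).2 ht'
      rw [hval t' z ht' hz']
      have e5 := DFunLike.congr_fun e4 (toUnit (t' / ε))
      have e6 : (constCurve E (ε, z).2 + (ε, z).1 • primitive E (Xc.comp (sol (ε, z))))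
          (toUnit (t' / ε)) =
          z + ε • ∫ v in (0 : ℝ)..(toUnit (t' / ε)), X (sol (ε, z) (toUnit v)) := rfl
      rw [e5, e6, coe_toUnit hs]
    constructor
    · change sol (0, z) (toUnit 1) = z
      rw [hform 0 (by simp [hε0.le])]
      simp
    · change HasDerivAt (fun t' => sol (t', z) (toUnit 1)) (X (sol (t, z) (toUnit 1))) t
      have hc : Continuous fun v => X (sol (ε, z) (toUnit v)) :=
        hX.continuous.comp ((sol (ε, z)).continuous.comp continuous_toUnit)
      have h1 : HasDerivAt (fun w => ∫ v in (0 : ℝ)..w, X (sol (ε, z) (toUnit v)))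
          (X (sol (ε, z) (toUnit (t / ε)))) (t / ε) :=
        intervalIntegral.integral_hasDerivAt_right (hc.intervalIntegrable _ _)
          hc.stronglyMeasurable.stronglyMeasurableAtFilter hc.continuousAt
      have h2 : HasDerivAt (fun t' : ℝ => t' / ε) (1 / ε) t := (hasDerivAt_id t).div_const ε
      have h3 := ((h1.scomp t h2).const_smul ε).const_add z
      rw [smul_smul, mul_one_div_cancel hε0.ne', one_smul, ← hval t z ht.le hz'] at h3
      refine h3.congr_of_eventuallyEq ?_
      have h4 : ∀ᶠ t' : ℝ in 𝓝 t, |t'| < ε := (continuous_abs.tendsto t).eventually (gt_mem_nhds ht)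
      filter_upwards [h4] with t' ht'
      exact hform t' ht'.le

end Flow

/-! ### Simultaneous straightening of commuting vector fields. -/

section Straighten

variable {E : Type u} [NormedAddCommGroup E] [NormedSpace ℝ E]

/-- `Φ` is a local flow of `X` near `p`. -/
structure IsLocalFlow (X : E → E) (p : E) (Φ : ℝ × E → E) : Prop where
  smooth : SmoothNear Φ (0, p)
  flow : ∀ᶠ q : ℝ × E in 𝓝 (0, p), Φ (0, q.2) = q.2 ∧
    HasDerivAt (fun t => Φ (t, q.2)) (X (Φ q)) q.1

theorem IsLocalFlow.map_base {X : E → E} {p : E} {Φ : ℝ × E → E} (h : IsLocalFlow X p Φ) :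
    Φ (0, p) = p := h.flow.self_of_nhds.1

theorem fderiv_apply_eq_of_hasDerivAt {F : Type*} [NormedAddCommGroup F] [NormedSpace ℝ F]
    {f : E → F} {z v : E} {w : F} (hf : ContDiffAt ℝ ∞ f z)
    (hw : HasDerivAt (fun s : ℝ => f (z + s • v)) w 0) : _root_.fderiv ℝ f z v = w :=
  ((hf.differentiableAt (by simp)).hasFDerivAt.hasLineDerivAt v).unique hw

/-- The flow of a vector field that is invariant under the translations along `v` commutes with
these translations. -/
theorem IsLocalFlow.translate {X : E → E} {p : E} {Φ : ℝ × E → E} (h : IsLocalFlow X p Φ)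
    (hX : SmoothNear X p) {v : E} (hv : ∀ᶠ x in 𝓝 p, fderiv ℝ X x v = 0) :
    ∀ᶠ q : ℝ × E in 𝓝 (0, p), ∀ᶠ s : ℝ in 𝓝 0, Φ (q.1, q.2 + s • v) = Φ q + s • v := by
  obtain ⟨K, t, ht, hK⟩ := (hX.self.of_le (m := 1) (by simp)).exists_lipschitzOnWith
  obtain ⟨r, hr, hball⟩ := Metric.eventually_nhds_iff_ball.1 ((hX.and hv).and
    (eventually_mem_set.2 ht))
  have hKr : LipschitzOnWith K X (Metric.ball p r) := hK.mono fun x hx => (hball x hx).2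
  have hinv : ∀ x, ∀ s : ℝ, x ∈ Metric.ball p r → x + s • v ∈ Metric.ball p r →
      X (x + s • v) = X x := by
    intro x s hx hxs
    have hconv : Convex ℝ ((fun τ : ℝ => x + τ • v) ⁻¹' Metric.ball p r) := by
      have : (fun τ : ℝ => x + τ • v) = AffineMap.lineMap x (x + v) := by
        ext τ
        simp [AffineMap.lineMap_apply, add_comm]
      rw [this]
      exact (convex_ball p r).affine_preimage _
    have h1 := hconv.norm_image_sub_le_of_norm_hasDerivWithin_le (f := fun τ => X (x + τ • v))
      (f' := fun _ => 0) (C := 0) (x := 0) (y := s) (fun τ hτ => ?_) (by simp) (by simpa using hx)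
      hxs
    · rw [zero_mul, norm_le_zero_iff, sub_eq_zero] at h1
      simpa using h1
    · obtain ⟨⟨h2, h3⟩, -⟩ := hball _ hτ
      have h4 : HasDerivAt (fun τ : ℝ => x + τ • v) v τ := by
        simpa using ((hasDerivAt_id τ).smul_const v).const_add x
      have h5 := (h2.differentiableAt (by simp)).hasFDerivAt.comp_hasDerivAt τ h4
      rw [h3] at h5
      exact h5.hasDerivWithinAt
  -- Half the radius leaves room for the translation by s • v.
  have hΦ : ∀ᶠ q : ℝ × E in 𝓝 (0, p), Φ q ∈ Metric.ball p (r / 2) := by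
    have hc := h.smooth.continuousAt
    rw [ContinuousAt, h.map_base] at hc
    exact hc.eventually (Metric.ball_mem_nhds _ (by positivity))
  obtain ⟨ρ, hρ, hρq⟩ := Metric.eventually_nhds_iff_ball.1 (h.flow.and hΦ)
  filter_upwards [Metric.ball_mem_nhds ((0 : ℝ), p) hρ] with q hq
  obtain ⟨t, x⟩ := q
  have hmem : ∀ t' : ℝ, ∀ y : E, t' ∈ Set.Ioo (-ρ) ρ → dist y p < ρ →
      (t', y) ∈ Metric.ball ((0 : ℝ), p) ρ := by
    intro t' y ht' hy
    rw [Metric.mem_ball, Prod.dist_eq, max_lt_iff]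
    refine ⟨?_, hy⟩
    rw [Real.dist_eq, sub_zero, abs_lt]
    exact ht'
  rw [Metric.mem_ball, Prod.dist_eq, max_lt_iff, Real.dist_eq, sub_zero, abs_lt] at hq
  obtain ⟨ht, hx⟩ := hq
  have hcont : ContinuousAt (fun s : ℝ => x + s • v) 0 := by fun_prop
  have h1 : ∀ᶠ s : ℝ in 𝓝 0, x + s • v ∈ Metric.ball p ρ := by
    refine hcont.eventually (Metric.isOpen_ball.mem_nhds ?_)
    simpa using hx
  have hcont2 : ContinuousAt (fun s : ℝ => s • v) 0 := by fun_prop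
  have h2 : ∀ᶠ s : ℝ in 𝓝 0, s • v ∈ Metric.ball (0 : E) (r / 2) := by
    refine hcont2.eventually (Metric.isOpen_ball.mem_nhds ?_)
    simp [hr]
  filter_upwards [h1, h2] with s hs1 hs2
  have hhalf : ∀ y ∈ Metric.ball p (r / 2), y ∈ Metric.ball p r ∧ y + s • v ∈ Metric.ball p r := by
    intro y hy
    rw [Metric.mem_ball] at hy
    rw [mem_ball_zero_iff] at hs2
    refine ⟨by rw [Metric.mem_ball]; linarith, ?_⟩
    rw [Metric.mem_ball]
    calc dist (y + s • v) p ≤ dist (y + s • v) y + dist y p := dist_triangle _ _ _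
      _ = ‖s • v‖ + dist y p := by rw [dist_eq_norm, add_sub_cancel_left]
      _ < r := by linarith
  -- The translated curve is again an integral curve since X is invariant along v, and both curves
  -- start at x + s • v; uniqueness for Lipschitz fields identifies them.
  have heq := ODE_solution_unique_of_mem_Ioo (v := fun _ => X) (s := fun _ => Metric.ball p r)
    (K := K) (f := fun t' => Φ (t', x + s • v)) (g := fun t' => Φ (t', x) + s • v)
    (a := -ρ) (b := ρ) (t₀ := 0) (fun _ _ => hKr) ⟨by linarith, hρ⟩ ?_ ?_ ?_
  · exact heq ht
  · intro t' ht'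
    obtain ⟨h3, h4⟩ := hρq _ (hmem t' _ ht' hs1)
    exact ⟨h3.2, (hhalf _ h4).1⟩
  · intro t' ht'
    obtain ⟨h3, h4⟩ := hρq _ (hmem t' _ ht' hx)
    obtain ⟨h5, h6⟩ := hhalf _ h4
    refine ⟨?_, h6⟩
    rw [hinv _ _ h5 h6]
    exact h3.2.add_const _
  · rw [(hρq _ (hmem 0 _ ⟨by linarith, hρ⟩ hs1)).1.1, (hρq _ (hmem 0 _ ⟨by linarith, hρ⟩ hx)).1.1]

variable [FiniteDimensional ℝ E]

/-- `exists_flow` wants a globally smooth field. A bump extension of X serves, since for short times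
and starting points near p the flow stays where the extension equals X. -/
theorem SmoothNear.exists_isLocalFlow {X : E → E} {p : E} (hX : SmoothNear X p) :
    ∃ Φ, IsLocalFlow X p Φ := by
  have := FiniteDimensional.complete ℝ E
  obtain ⟨Y, hY, hYX⟩ := hX.exists_contDiff
  obtain ⟨Φ, hΦ, hflow⟩ := exists_flow hY p
  have h0 : Φ (0, p) = p := hflow.self_of_nhds.1
  have hc := hΦ.continuousAt
  rw [ContinuousAt, h0] at hc
  refine ⟨Φ, hΦ, ?_⟩
  filter_upwards [hflow, hc.eventually hYX] with q hq hq2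
  exact ⟨hq.1, hq2 ▸ hq.2⟩

/-- A vector field `Y` that is invariant under the translations along the vectors `v i` can be made
constant by a local diffeomorphism that commutes with these translations. -/
theorem exists_rectify {ι : Type*} {Y : E → E} {p : E} (hY : SmoothNear Y p) (v : ι → E)
    (hv : ∀ i, ∀ᶠ x in 𝓝 p, fderiv ℝ Y x (v i) = 0) (L : E →L[ℝ] ℝ) (hLY : L (Y p) = 1)
    (hLv : ∀ i, L (v i) = 0) :
    ∃ Ψ : E → E, SmoothNear Ψ p ∧ Ψ p = p ∧ fderiv ℝ Ψ p = ContinuousLinearMap.id ℝ E ∧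
      (∀ᶠ z in 𝓝 p, fderiv ℝ Ψ z (Y p) = Y (Ψ z)) ∧
      ∀ i, ∀ᶠ z in 𝓝 p, fderiv ℝ Ψ z (v i) = v i := by
  obtain ⟨Φ, hΦ⟩ := hY.exists_isLocalFlow
  set w := Y p with hw
  -- The rectifying map is Φ ∘ A: project z along w onto the hyperplane through p parallel to the
  -- kernel of L, then follow Y for time L (z - p).
  let A : E → ℝ × E := fun z => (L (z - p), z - L (z - p) • w)
  have hA : ContDiff ℝ ∞ A := by
    have h1 : ContDiff ℝ ∞ fun z : E => L (z - p) :=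
      L.contDiff.comp (contDiff_id.sub contDiff_const)
    exact h1.prodMk (contDiff_id.sub (h1.smul contDiff_const))
  have hAp : A p = (0, p) := by simp [A]
  have hΨ : SmoothNear (fun z => Φ (A z)) p :=
    SmoothNear.comp (f := A) (by rw [hAp]; exact hΦ.smooth) (.of_contDiff hA p)
  have hAt : Tendsto A (𝓝 p) (𝓝 (0, p)) := hAp ▸ hA.continuous.tendsto p
  have hAline : ∀ z u : E, ∀ s : ℝ, L u = 0 → A (z + s • u) = ((A z).1, (A z).2 + s • u) := by
    intro z u s hu
    have : L (z + s • u - p) = L (z - p) := by simp [hu]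
    simp only [A, this]
    rw [add_sub_right_comm]
  have hdw : ∀ᶠ z in 𝓝 p, fderiv ℝ (fun z => Φ (A z)) z w = Y (Φ (A z)) := by
    filter_upwards [hΨ, hAt.eventually hΦ.flow] with z hz hq
    apply fderiv_apply_eq_of_hasDerivAt hz
    have h1 : (fun s : ℝ => Φ (A (z + s • w))) = fun s : ℝ => Φ (L (z - p) + s, (A z).2) := by
      funext s
      congr 1
      have : L (z + s • w - p) = L (z - p) + s := by
        rw [add_sub_right_comm, map_add, map_smul, hLY, smul_eq_mul, mul_one]
      simp only [A, this]
      congr 1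
      rw [add_smul]
      abel
    rw [h1]
    have h2 := hq.2
    have h3 : HasDerivAt (fun s : ℝ => L (z - p) + s) 1 0 := (hasDerivAt_id (0 : ℝ)).const_add _
    have h4 : HasDerivAt (fun t => Φ (t, (A z).2)) (Y (Φ (A z))) (L (z - p) + 0) := by
      rw [add_zero]
      exact h2
    have h5 := h4.scomp (0 : ℝ) h3
    rw [one_smul] at h5
    exact h5
  refine ⟨fun z => Φ (A z), hΨ, ?_, ?_, hdw, fun i => ?_⟩
  · change Φ (A p) = p
    rw [hAp, hΦ.map_base]
  -- Along the hyperplane the time is 0 and Φ is the identity there; since w goes to Y p = w, the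
  -- derivative at p is the identity.
  · have hker : ∀ u : E, L u = 0 → fderiv ℝ (fun z => Φ (A z)) p u = u := by
      intro u hu
      apply fderiv_apply_eq_of_hasDerivAt hΨ.self
      have h1 : HasDerivAt (fun s : ℝ => p + s • u) u 0 := by
        simpa using ((hasDerivAt_id (0 : ℝ)).smul_const u).const_add p
      refine h1.congr_of_eventuallyEq ?_
      have hc : ContinuousAt (fun s : ℝ => ((0 : ℝ), p + s • u)) 0 := by fun_prop
      have hc' : Tendsto (fun s : ℝ => ((0 : ℝ), p + s • u)) (𝓝 0) (𝓝 (0, p)) := by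
        have := hc.tendsto
        simpa using this
      filter_upwards [hc'.eventually hΦ.flow] with s hs
      rw [hAline p u s hu, hAp]
      exact hs.1
    refine ContinuousLinearMap.ext fun u => ?_
    have h1 : u = (u - L u • w) + L u • w := by abel
    have h2 := hker (u - L u • w) (by simp [hLY])
    have h3 : fderiv ℝ (fun z => Φ (A z)) p w = w := by
      rw [hdw.self_of_nhds, hAp, hΦ.map_base]
    conv_lhs => rw [h1]
    rw [map_add, map_smul, h2, h3, ← h1]
    rfl
  · filter_upwards [hΨ, hAt.eventually (hΦ.translate hY (hv i))] with z hz hq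
    apply fderiv_apply_eq_of_hasDerivAt hz
    have h1 : HasDerivAt (fun s : ℝ => Φ (A z) + s • v i) (v i) 0 := by
      simpa using ((hasDerivAt_id (0 : ℝ)).smul_const (v i)).const_add (Φ (A z))
    refine h1.congr_of_eventuallyEq ?_
    filter_upwards [hq] with s hs
    rw [hAline z (v i) s (hLv i)]
    exact hs

/-- The composition of a map with the local inverse of a local diffeomorphism. -/
theorem exists_comp_localInverse {Ψ g : E → E} {p : E} (hΨ : SmoothNear Ψ p) (hΨp : Ψ p = p)
    (hdΨ : fderiv ℝ Ψ p = ContinuousLinearMap.id ℝ E) (hg : SmoothNear g p) (hgp : g p = p)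
    (hdg : fderiv ℝ g p = ContinuousLinearMap.id ℝ E) :
    ∃ f : E → E, SmoothNear f p ∧ f p = p ∧ fderiv ℝ f p = ContinuousLinearMap.id ℝ E ∧
      (∀ᶠ z in 𝓝 p, Ψ (f z) = g z) ∧
      ∀ᶠ z in 𝓝 p, ∀ u w : E, fderiv ℝ g z u = fderiv ℝ Ψ (f z) w → fderiv ℝ f z u = w := by
  have := FiniteDimensional.complete ℝ E
  obtain ⟨h, rfl, hp, -, hs, hs'⟩ :=
    hΨ.exists_openPartialHomeomorph (ContinuousLinearEquiv.refl ℝ E)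
    hdΨ univ_mem
  have hpt : p ∈ h.target := by
    have := h.map_source hp
    rwa [hΨp] at this
  have hsymm : SmoothNear h.symm p := .of_contDiffOn hs' h.open_target hpt
  have hsp : h.symm p = p := by
    conv_lhs => rw [← hΨp]
    exact h.left_inv hp
  have hf : SmoothNear (fun z => h.symm (g z)) p :=
    SmoothNear.comp (g := h.symm) (by rw [hgp]; exact hsymm) hg
  have hgt : Tendsto g (𝓝 p) (𝓝 p) := by
    have := hg.continuousAt.tendsto
    rwa [hgp] at this
  have hkey : ∀ᶠ z in 𝓝 p, fderiv ℝ g z =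
        (fderiv ℝ h (h.symm (g z))).comp (fderiv ℝ (fun z => h.symm (g z)) z) ∧
      Function.Injective (fderiv ℝ h (h.symm (g z))) := by
    filter_upwards [hg, hf, hgt.eventually (h.open_target.mem_nhds hpt),
      (hgt.eventually (h.open_target.mem_nhds hpt)).eventually_nhds] with z h1 h2 h3 h4
    have hsrc := h.map_target h3
    have h5 : DifferentiableAt ℝ h (h.symm (g z)) :=
      (hs.contDiffAt (h.open_source.mem_nhds hsrc)).differentiableAt (by simp)
    have h6 : DifferentiableAt ℝ h.symm (g z) :=
      (hs'.contDiffAt (h.open_target.mem_nhds h3)).differentiableAt (by simp)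
    constructor
    · rw [← fderiv_comp z h5 (h2.differentiableAt (by simp))]
      apply EventuallyEq.fderiv_eq
      filter_upwards [h4] with y hy
      exact (h.right_inv hy).symm
    · intro a b hab
      have h7 : (fderiv ℝ h.symm (g z)).comp (fderiv ℝ h (h.symm (g z))) =
          ContinuousLinearMap.id ℝ E := by
        have h8 : DifferentiableAt ℝ h.symm (h (h.symm (g z))) := by rwa [h.right_inv h3]
        have := fderiv_comp (h.symm (g z)) h8 h5
        rw [h.right_inv h3] at this
        rw [← this]
        have h9 : (h.symm ∘ h) =ᶠ[𝓝 (h.symm (g z))] id := by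
          filter_upwards [h.open_source.mem_nhds hsrc] with y hy using h.left_inv hy
        rw [h9.fderiv_eq, fderiv_id]
      have h8 := congrArg (fderiv ℝ h.symm (g z)) hab
      rw [← ContinuousLinearMap.comp_apply, ← ContinuousLinearMap.comp_apply, h7] at h8
      exact h8
  have hkey2 : ∀ᶠ z in 𝓝 p, ∀ u w : E, fderiv ℝ g z u = fderiv ℝ h (h.symm (g z)) w →
      fderiv ℝ (fun z => h.symm (g z)) z u = w := by
    filter_upwards [hkey] with z hz u w huw
    rw [hz.1] at huw
    exact hz.2 huw
  refine ⟨fun z => h.symm (g z), hf, by simp only [hgp, hsp], ?_, ?_, hkey2⟩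
  swap
  · filter_upwards [hgt.eventually (h.open_target.mem_nhds hpt)] with z hz using h.right_inv hz
  refine ContinuousLinearMap.ext fun u => hkey2.self_of_nhds u u ?_
  rw [hgp, hsp, hdΨ, hdg]

/-- Commuting linearly independent vector fields can be made constant simultaneously. -/
theorem exists_straighten {ι : Type*} [DecidableEq ι] {X : ι → E → E} {p : E} (s : Finset ι)
    (hX : ∀ i ∈ s, SmoothNear (X i) p)
    (hcomm : ∀ i ∈ s, ∀ j ∈ s, ∀ᶠ z in 𝓝 p, VectorField.lieBracket ℝ (X i) (X j) z = 0)
    (hind : LinearIndepOn ℝ (fun i => X i p) (s : Set ι)) :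
    ∃ g : E → E, SmoothNear g p ∧ g p = p ∧ fderiv ℝ g p = ContinuousLinearMap.id ℝ E ∧
      ∀ i ∈ s, ∀ᶠ z in 𝓝 p, fderiv ℝ g z (X i z) = X i p := by
  have := FiniteDimensional.complete ℝ E
  induction s using Finset.induction_on with
  | empty =>
    exact ⟨id, .of_contDiff contDiff_id p, rfl, fderiv_id, by simp⟩
  | insert a s ha ih =>
    obtain ⟨g, hg, hgp, hdg, hgX⟩ := ih (fun i hi => hX i (Finset.mem_insert_of_mem hi))
      (fun i hi j hj => hcomm i (Finset.mem_insert_of_mem hi) j (Finset.mem_insert_of_mem hj))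
      (hind.mono (by simp))
    obtain ⟨h, rfl, hp, -, hs, hs'⟩ := hg.exists_openPartialHomeomorph
      (ContinuousLinearEquiv.refl ℝ E) hdg univ_mem
    have hpt : p ∈ h.target := by
      have := h.map_source hp
      rwa [hgp] at this
    have hsp : h.symm p = p := by
      conv_lhs => rw [← hgp]
      exact h.left_inv hp
    have hsymm : SmoothNear h.symm p := .of_contDiffOn hs' h.open_target hpt
    have hXa : SmoothNear (X a) p := hX a (Finset.mem_insert_self a s)
    have hW : SmoothNear (fun z => fderiv ℝ h z (X a z)) p := hg.fderiv.clm_apply hXa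
    have hY : SmoothNear (fun x => fderiv ℝ h (h.symm x) (X a (h.symm x))) p :=
      SmoothNear.comp (g := fun z => fderiv ℝ h z (X a z)) (by rw [hsp]; exact hW) hsymm
    -- Y is the pushforward of X a by the diffeomorphism that straightens the earlier fields.
    set Y : E → E := fun x => fderiv ℝ h (h.symm x) (X a (h.symm x)) with hYdef
    have hYp : Y p = X a p := by
      simp only [hYdef, hsp, hdg]
      rfl
    have hYh : ∀ᶠ z in 𝓝 p, Y (h z) = fderiv ℝ h z (X a z) := by
      filter_upwards [h.open_source.mem_nhds hp] with z hz
      simp only [hYdef, h.left_inv hz]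
    have hst : Tendsto h.symm (𝓝 p) (𝓝 p) := by
      have := hsymm.continuousAt.tendsto
      rwa [hsp] at this
    have hht : Tendsto h (𝓝 p) (𝓝 p) := by
      have := hg.continuousAt.tendsto
      rwa [hgp] at this
    -- The pushforward of X i is the constant field X i p. By naturality of the Lie bracket it
    -- commutes with Y, which for a constant field means that Y has zero derivative along it.
    have hinv : ∀ i ∈ s, ∀ᶠ x in 𝓝 p, fderiv ℝ Y x (X i p) = 0 := by
      intro i hi
      have hXi := hX i (Finset.mem_insert_of_mem hi)
      have h1 : ∀ᶠ z in 𝓝 p, fderiv ℝ Y (h z) (X i p) = 0 := by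
        filter_upwards [hg, hXa, hXi, hht.eventually hY, hYh.eventually_nhds, hgX i hi,
          (hgX i hi).eventually_nhds,
          hcomm i (Finset.mem_insert_of_mem hi) a (Finset.mem_insert_self a s)]
          with z h1 h2 h3 h4 h5 h6 h7 h8
        have e1 := VectorField.fderiv_apply_lieBracket (f := h) (V := X i) (W := X a) h1
          (by rw [minSmoothness_of_isRCLikeNormedField]; exact ENat.LEInfty.out)
          (h2.differentiableAt (by simp))
          (h3.differentiableAt (by simp))
        have h7' : (fun x => fderiv ℝ h x (X i x)) =ᶠ[𝓝 z] fun _ => X i p := h7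
        have h5' : (fun x => fderiv ℝ h x (X a x)) =ᶠ[𝓝 z] Y ∘ h := by
          filter_upwards [h5] with y hy using hy.symm
        rw [h8, map_zero, h7'.fderiv_eq, h5'.fderiv_eq,
          fderiv_comp z (h4.differentiableAt (by simp)) (h1.differentiableAt (by simp)),
          ContinuousLinearMap.comp_apply, h6] at e1
        simpa using e1.symm
      filter_upwards [hst.eventually h1, h.open_target.mem_nhds hpt] with x hx hxt
      rwa [h.right_inv hxt] at hx
    -- X a p lies outside the span of the earlier values X i p, so a linear form separates it from
    -- them.
    obtain ⟨L, hLa, hLs⟩ : ∃ L : E →L[ℝ] ℝ, L (Y p) = 1 ∧ ∀ i : s, L (X i p) = 0 := by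
      rw [Finset.coe_insert, linearIndepOn_insert (by simpa using ha)] at hind
      obtain ⟨l, hl, hls⟩ := Submodule.exists_le_ker_of_notMem hind.2
      refine ⟨LinearMap.toContinuousLinearMap ((l (X a p))⁻¹ • l), ?_, fun i => ?_⟩
      · rw [hYp]
        simp [hl]
      · have : l (X i p) = 0 := hls (Submodule.subset_span ⟨i, i.2, rfl⟩)
        simp [this]
    -- The new map is Ψ⁻¹ ∘ g: Ψ⁻¹ makes Y constant and leaves the directions already straightened
    -- alone.
    obtain ⟨Ψ, hΨ, hΨp, hdΨ, hΨY, hΨv⟩ := exists_rectify hY (fun i : s => X i p)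
      (fun i => hinv i i.2) L hLa hLs
    obtain ⟨f, hf, hfp, hdf, hΨf, hkey⟩ := exists_comp_localInverse hΨ hΨp hdΨ hg hgp hdg
    have hft : Tendsto f (𝓝 p) (𝓝 p) := by
      have := hf.continuousAt.tendsto
      rwa [hfp] at this
    refine ⟨f, hf, hfp, hdf, fun i hi => ?_⟩
    rcases Finset.mem_insert.1 hi with rfl | hi
    · filter_upwards [hkey, hΨf, hft.eventually hΨY, hYh] with z h1 h2 h3 h4
      apply h1
      rw [← hYp, h3, h2, h4]
    · filter_upwards [hkey, hft.eventually (hΨv ⟨i, hi⟩), hgX i hi] with z h1 h2 h3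
      apply h1
      rw [h2, h3]

end Straighten

/-! ### Completion of functions to local coordinates. -/

section Coordinates

variable {N : ℕ}

theorem exists_linearIndependent_mem {V ι : Type*} [AddCommGroup V] [Module ℝ V]
    [FiniteDimensional ℝ V] [Fintype ι] (W : Submodule ℝ V)
    (hW : Module.finrank ℝ W = Fintype.card ι) :
    ∃ m : ι → V, LinearIndependent ℝ m ∧ ∀ i, m i ∈ W := by
  let m : Module.Basis ι ℝ W := (Module.finBasis ℝ W).reindex
    (Fintype.equivOfCardEq (by rw [Fintype.card_fin, hW]))
  exact ⟨fun i => m i, m.linearIndependent.map' W.subtype W.ker_subtype, fun i => (m i).2⟩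

/-- There are as many independent linear forms vanishing on a family of independent vectors as
there are remaining slots. -/
theorem exists_annihilator {κ : Type*} [Fintype κ] {σ : κ → Fin N}
    (hσ : Function.Injective σ) {v : κ → Phase N} (hv : LinearIndependent ℝ v) :
    ∃ M : {i // i ∉ Set.range σ} → (Phase N →L[ℝ] ℝ), LinearIndependent ℝ M ∧
      ∀ i a, M i (v a) = 0 := by
  classical
  let V : Submodule ℝ (Phase N) := Submodule.span ℝ (Set.range v)
  let W : Submodule ℝ (Module.Dual ℝ (Phase N)) := V.dualAnnihilator
  have hVr : Module.finrank ℝ V = Fintype.card κ := finrank_span_eq_card hv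
  have hAr : Module.finrank ℝ W = Fintype.card {i // i ∉ Set.range σ} := by
    have h1 : Module.finrank ℝ V + Module.finrank ℝ W = _ :=
      Subspace.finrank_add_finrank_dualAnnihilator_eq V
    have h2 : Fintype.card {i // i ∉ Set.range σ} = N - Fintype.card κ := by
      rw [Fintype.card_subtype_compl, Fintype.card_fin]
      congr 1
      exact (Fintype.card_congr (Equiv.ofInjective σ hσ)).symm
    rw [hVr, Module.finrank_fin_fun] at h1
    omega
  obtain ⟨m, hm, hmW⟩ := exists_linearIndependent_mem W hAr
  let e : Module.Dual ℝ (Phase N) ≃ₗ[ℝ] (Phase N →L[ℝ] ℝ) := LinearMap.toContinuousLinearMap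
  exact ⟨fun i => e (m i), hm.map' e.toLinearMap e.ker, fun i a =>
    (Submodule.mem_dualAnnihilator _).1 (hmW i) _ (Submodule.subset_span ⟨a, rfl⟩)⟩

/-- Functions with prescribed values in some slots that restrict to coordinates on the common level
sets of commuting vector fields can be completed by joint first integrals of these fields. -/
theorem exists_coordinates {κ : Type*} [Fintype κ] {p : Phase N} {σ : κ → Fin N}
    (hσ : Function.Injective σ) {f : κ → Phase N → ℝ} {X : κ → Phase N → Phase N}
    (hf : ∀ a, SmoothNear (f a) p) (hX : ∀ a, SmoothNear (X a) p)
    (hcomm : ∀ a b, ∀ᶠ z in 𝓝 p, VectorField.lieBracket ℝ (X a) (X b) z = 0)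
    (hind : LinearIndependent ℝ fun a => X a p)
    (hdual : ∀ c : κ → ℝ, (∀ a, ∑ b, c b * fderiv ℝ (f b) p (X a p) = 0) → c = 0) :
    ∃ F : Fin N → Phase N → ℝ, (∀ i, SmoothNear (F i) p) ∧ (∀ a, F (σ a) = f a) ∧
      (∀ a, ∀ i ∉ Set.range σ, ∀ᶠ z in 𝓝 p, fderiv ℝ (F i) z (X a z) = 0) ∧
      LinearIndependent ℝ fun i => fderiv ℝ (F i) p := by
  classical
  obtain ⟨g, hg, hgp, hdg, hgX⟩ := exists_straighten (p := p) Finset.univ (fun a _ => hX a)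
    (fun a _ b _ => hcomm a b) (by simpa [linearIndepOn_univ_iff] using hind)
  obtain ⟨M, hM, hMX⟩ := exists_annihilator hσ hind
  have hMg : ∀ i, SmoothNear (fun z => M i (g z)) p := fun i =>
    SmoothNear.comp (g := M i) (.of_contDiff (M i).contDiff _) hg
  have hdMg : ∀ i, ∀ᶠ z in 𝓝 p, fderiv ℝ (fun z => M i (g z)) z = (M i).comp (fderiv ℝ g z) := by
    intro i
    filter_upwards [hg] with z hz
    exact ((M i).hasFDerivAt.comp z (hz.differentiableAt (by simp)).hasFDerivAt).fderiv
  let F : Fin N → Phase N → ℝ := fun i =>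
    if h : i ∈ Set.range σ then f h.choose else fun z => M ⟨i, h⟩ (g z)
  have hFσ : ∀ a, F (σ a) = f a := by
    intro a
    have h : σ a ∈ Set.range σ := ⟨a, rfl⟩
    simp only [F, dif_pos h]
    rw [hσ h.choose_spec]
  have hFM : ∀ i (h : i ∉ Set.range σ), F i = fun z => M ⟨i, h⟩ (g z) := fun i h => dif_neg h
  refine ⟨F, ?_, hFσ, ?_, ?_⟩
  · intro i
    by_cases h : i ∈ Set.range σ
    · obtain ⟨a, rfl⟩ := h
      rw [hFσ]
      exact hf a
    · rw [hFM i h]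
      exact hMg _
  · intro a i hi
    rw [hFM i hi]
    filter_upwards [hdMg ⟨i, hi⟩, hgX a (Finset.mem_univ a)] with z h1 h2
    rw [h1, ContinuousLinearMap.comp_apply, h2, hMX]
  · rw [Fintype.linearIndependent_iff]
    intro c hc
    have hdF : ∀ i (h : i ∉ Set.range σ), fderiv ℝ (F i) p = M ⟨i, h⟩ := by
      intro i h
      rw [hFM i h, (hdMg _).self_of_nhds, hdg]
      rfl
    have hsplit : ∀ G : Fin N → (Phase N →L[ℝ] ℝ), ∑ i, G i =
        ∑ a, G (σ a) + ∑ i : {i // i ∉ Set.range σ}, G i := by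
      intro G
      rw [← Fintype.sum_subtype_add_sum_subtype (fun i => i ∈ Set.range σ) G]
      congr 1
      symm
      convert Fintype.sum_equiv (Equiv.ofInjective σ hσ : κ ≃ {i // i ∈ Set.range σ})
        (fun a => G (σ a))
        (fun i : {i // i ∈ Set.range σ} => G i) (fun _ => rfl)
    rw [hsplit] at hc
    -- Evaluated at X a p, a linear relation loses the forms M i and leaves only the nondegenerate
    -- pairing of the differentials of f with the fields.
    have hcσ : (fun a => c (σ a)) = 0 := by
      apply hdual
      intro a
      have h1 := congrArg (fun l : Phase N →L[ℝ] ℝ => l (X a p)) hc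
      simp only [_root_.add_apply, _root_.sum_apply,
        _root_.smul_apply, smul_eq_mul, _root_.zero_apply, hFσ] at h1
      rw [Finset.sum_eq_zero (s := (Finset.univ : Finset {i // i ∉ Set.range σ}))
        (fun i _ => by rw [hdF i i.2, hMX, mul_zero]), add_zero] at h1
      exact h1
    have h2 : ∑ i : {i // i ∉ Set.range σ}, c i • M i = 0 := by
      rw [Finset.sum_eq_zero (s := (Finset.univ : Finset κ))
        (fun a _ => by rw [show c (σ a) = 0 from congrFun hcσ a, zero_smul]), zero_add] at hc
      rw [← hc]
      exact Finset.sum_congr rfl fun i _ => by rw [hdF i i.2]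
    intro i
    by_cases h : i ∈ Set.range σ
    · obtain ⟨a, rfl⟩ := h
      exact congrFun hcσ a
    · exact Fintype.linearIndependent_iff.1 hM (fun i => c i) h2 ⟨i, h⟩

/-- Functions with independent differentials are local coordinates. -/
theorem exists_isCoordChange {p : Phase N} {F : Fin N → Phase N → ℝ}
    (hF : ∀ i, SmoothNear (F i) p) (hind : LinearIndependent ℝ fun i => fderiv ℝ (F i) p)
    {U : Set (Phase N)} (hU : U ∈ 𝓝 p) :
    ∃ h : OpenPartialHomeomorph (Phase N) (Phase N), IsCoordChange h ∧ p ∈ h.source ∧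
      h.source ⊆ U ∧ ∀ z i, h z i = F i z := by
  let H : Phase N → Phase N := fun z i => F i z
  have hH : SmoothNear H p := SmoothNear.pi hF
  have hD : ∀ v i, fderiv ℝ H p v i = fderiv ℝ (F i) p v := by
    intro v i
    have : HasFDerivAt H (ContinuousLinearMap.pi fun i => fderiv ℝ (F i) p) p :=
      hasFDerivAt_pi.2 fun i => (hF i).differentiableAt.hasFDerivAt
    rw [this.fderiv]
    rfl
  -- The dual map sends φ to the combination of the differentials of the F i with coefficients
  -- φ(e_i), so its injectivity is their independence.
  have hsurj : Function.Surjective (fderiv ℝ H p : Phase N →ₗ[ℝ] Phase N) := by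
    rw [← LinearMap.dualMap_injective_iff, injective_iff_map_eq_zero]
    intro φ hφ
    have h1 : ∑ i, φ (Pi.single i 1) • fderiv ℝ (F i) p = 0 := by
      refine ContinuousLinearMap.ext fun v => ?_
      have h2 := congrArg (fun l : Module.Dual ℝ (Phase N) => l v) hφ
      simp only [LinearMap.dualMap_apply, LinearMap.zero_apply] at h2
      rw [LinearMap.pi_apply_eq_sum_univ φ] at h2
      simp only [ContinuousLinearMap.coe_coe, hD, smul_eq_mul] at h2
      simp only [_root_.sum_apply, _root_.smul_apply, smul_eq_mul,
        _root_.zero_apply]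
      rw [← h2]
      refine Finset.sum_congr rfl fun i _ => ?_
      rw [mul_comm]
      congr 2
      ext j
      simp [Pi.single_apply, eq_comm]
    have h3 := Fintype.linearIndependent_iff.1 hind _ h1
    refine LinearMap.pi_ext' fun i => LinearMap.ext_ring ?_
    simpa using h3 i
  let e : Phase N ≃L[ℝ] Phase N := (LinearEquiv.ofBijective (fderiv ℝ H p : Phase N →ₗ[ℝ] Phase N)
    ⟨LinearMap.injective_iff_surjective.2 hsurj, hsurj⟩).toContinuousLinearEquiv
  have he : fderiv ℝ H p = e := by
    ext v
    rfl
  obtain ⟨h, hh, hp, hs, h1, h2⟩ := hH.exists_openPartialHomeomorph e he hU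
  exact ⟨h, ⟨h1, h2⟩, hp, hs, fun z i => by rw [hh]⟩

end Coordinates

/-! ### Nambu brackets and their Hamiltonian fields. -/

section Brackets

variable {N : ℕ}

theorem fderiv_apply_eq_sum (A : Phase N → ℝ) (z v : Phase N) :
    fderiv ℝ A z v = ∑ k, v k * pderiv k A z := by
  have h := LinearMap.pi_apply_eq_sum_univ (fderiv ℝ A z : Phase N →ₗ[ℝ] ℝ) v
  simp only [ContinuousLinearMap.coe_coe, smul_eq_mul] at h
  rw [h]
  refine Finset.sum_congr rfl fun i _ => ?_
  rw [pderiv]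
  congr 2
  ext j
  simp [Pi.single_apply, eq_comm]

theorem SmoothNear.pderiv {A : Phase N → ℝ} {p : Phase N} (hA : SmoothNear A p) (i : Fin N) :
    SmoothNear (NambuLocal.pderiv i A) p :=
  hA.fderiv.clm_apply (.const _ p)

theorem smoothNear_coord (i : Fin N) (p : Phase N) : SmoothNear (fun z : Phase N => z i) p :=
  .of_contDiff (contDiff_apply ℝ ℝ i) p

theorem fderiv_coord (i : Fin N) (z : Phase N) :
    fderiv ℝ (fun z : Phase N => z i) z = ContinuousLinearMap.proj i :=
  (ContinuousLinearMap.proj (R := ℝ) (φ := fun _ : Fin N => ℝ) i).fderiv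

theorem pderiv_coord (i j : Fin N) (z : Phase N) :
    pderiv i (fun z : Phase N => z j) z = if i = j then 1 else 0 := by
  rw [pderiv, fderiv_coord]
  simp [Pi.single_apply, eq_comm]

/-- The trilinear form on covectors given by a tensor. -/
def triForm (T : TriTensor N) (z : Phase N) (α β γ : Phase N →L[ℝ] ℝ) : ℝ :=
  ∑ i, ∑ j, ∑ k, T z i j k * α (Pi.single i 1) * β (Pi.single j 1) * γ (Pi.single k 1)

theorem nambuBracket_eq_triForm (T : TriTensor N) (A B C : Phase N → ℝ) (z : Phase N) :
    nambuBracket T A B C z = triForm T z (fderiv ℝ A z) (fderiv ℝ B z) (fderiv ℝ C z) := rfl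

theorem triForm_add (T : TriTensor N) (z : Phase N) (α α' β γ : Phase N →L[ℝ] ℝ) :
    triForm T z (α + α') β γ = triForm T z α β γ + triForm T z α' β γ := by
  simp only [triForm, ← Finset.sum_add_distrib, _root_.add_apply]
  refine Finset.sum_congr rfl fun i _ => Finset.sum_congr rfl fun j _ =>
    Finset.sum_congr rfl fun k _ => ?_
  ring

theorem triForm_smul (T : TriTensor N) (z : Phase N) (c : ℝ) (α β γ : Phase N →L[ℝ] ℝ) :
    triForm T z (c • α) β γ = c * triForm T z α β γ := by
  simp only [triForm, Finset.mul_sum, _root_.smul_apply, smul_eq_mul]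
  refine Finset.sum_congr rfl fun i _ => Finset.sum_congr rfl fun j _ =>
    Finset.sum_congr rfl fun k _ => ?_
  ring

theorem triForm_zero (T : TriTensor N) (z : Phase N) (β γ : Phase N →L[ℝ] ℝ) :
    triForm T z 0 β γ = 0 := by
  simpa using triForm_smul T z 0 0 β γ

/-- The Hamiltonian vector field of a pair of functions for a Nambu bracket. -/
def nambuField (T : TriTensor N) (A B : Phase N → ℝ) (z : Phase N) : Phase N :=
  fun k => ∑ i, ∑ j, T z i j k * pderiv i A z * pderiv j B z

theorem nambuBracket_eq_fderiv (T : TriTensor N) (A B C : Phase N → ℝ) (z : Phase N) :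
    nambuBracket T A B C z = fderiv ℝ C z (nambuField T A B z) := by
  rw [fderiv_apply_eq_sum]
  simp only [nambuBracket, nambuField, Finset.sum_mul]
  symm
  rw [Finset.sum_comm]
  refine Finset.sum_congr rfl fun i _ => ?_
  rw [Finset.sum_comm]

variable {T : TriTensor N} {U : Set (Phase N)}

theorem nambuField_apply (A B : Phase N → ℝ) (k : Fin N) :
    (fun z => nambuField T A B z k) = nambuBracket T A B fun z => z k := by
  funext z
  rw [nambuBracket_eq_fderiv, fderiv_coord]
  rfl

theorem nambuBracket_congr {A A' B B' C C' : Phase N → ℝ} {z : Phase N} (hA : A' =ᶠ[𝓝 z] A)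
    (hB : B' =ᶠ[𝓝 z] B) (hC : C' =ᶠ[𝓝 z] C) :
    nambuBracket T A' B' C' =ᶠ[𝓝 z] nambuBracket T A B C := by
  filter_upwards [hA.eventually_nhds, hB.eventually_nhds, hC.eventually_nhds] with w h1 h2 h3
  rw [nambuBracket_eq_triForm, nambuBracket_eq_triForm, EventuallyEq.fderiv_eq h1,
    EventuallyEq.fderiv_eq h2, EventuallyEq.fderiv_eq h3]

namespace IsNambuTensor

theorem smoothNear (hT : IsNambuTensor U T) (hU : IsOpen U) {z : Phase N} (hz : z ∈ U)
    (i j k : Fin N) : SmoothNear (fun z => T z i j k) z :=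
  .of_contDiffOn (hT.smooth i j k) hU hz

theorem triForm_swap_left (hT : IsNambuTensor U T) {z : Phase N} (hz : z ∈ U)
    (α β γ : Phase N →L[ℝ] ℝ) : triForm T z β α γ = -triForm T z α β γ := by
  simp only [triForm, ← Finset.sum_neg_distrib]
  rw [Finset.sum_comm]
  refine Finset.sum_congr rfl fun i _ => Finset.sum_congr rfl fun j _ =>
    Finset.sum_congr rfl fun k _ => ?_
  rw [hT.antisymm_left z hz i j k]
  ring

theorem triForm_swap_right (hT : IsNambuTensor U T) {z : Phase N} (hz : z ∈ U)
    (α β γ : Phase N →L[ℝ] ℝ) : triForm T z α γ β = -triForm T z α β γ := by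
  simp only [triForm, ← Finset.sum_neg_distrib]
  refine Finset.sum_congr rfl fun i _ => ?_
  rw [Finset.sum_comm]
  refine Finset.sum_congr rfl fun j _ =>
    Finset.sum_congr rfl fun k _ => ?_
  rw [hT.antisymm_right z hz i j k]
  ring

theorem triForm_rotate (hT : IsNambuTensor U T) {z : Phase N} (hz : z ∈ U)
    (α β γ : Phase N →L[ℝ] ℝ) : triForm T z β γ α = triForm T z α β γ := by
  rw [hT.triForm_swap_right hz β α γ, hT.triForm_swap_left hz, neg_neg]

theorem nambuBracket_rotate (hT : IsNambuTensor U T) {z : Phase N} (hz : z ∈ U)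
    (A B C : Phase N → ℝ) : nambuBracket T B C A z = nambuBracket T A B C z :=
  hT.triForm_rotate hz _ _ _

theorem smoothNear_nambuBracket (hT : IsNambuTensor U T) (hU : IsOpen U) {z : Phase N} (hz : z ∈ U)
    {A B C : Phase N → ℝ} (hA : SmoothNear A z) (hB : SmoothNear B z) (hC : SmoothNear C z) :
    SmoothNear (nambuBracket T A B C) z :=
  .sum fun i _ => .sum fun j _ => .sum fun k _ =>
    (((hT.smoothNear hU hz i j k).mul (hA.pderiv i)).mul (hB.pderiv j)).mul (hC.pderiv k)

theorem smoothNear_nambuField (hT : IsNambuTensor U T) (hU : IsOpen U) {z : Phase N} (hz : z ∈ U)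
    {A B : Phase N → ℝ} (hA : SmoothNear A z) (hB : SmoothNear B z) :
    SmoothNear (nambuField T A B) z :=
  .pi fun k => .sum fun i _ => .sum fun j _ =>
    ((hT.smoothNear hU hz i j k).mul (hA.pderiv i)).mul (hB.pderiv j)

/-- The fundamental identity holds for functions that are smooth near a point. -/
theorem fundamental_near (hT : IsNambuTensor U T) {z : Phase N} (hz : z ∈ U)
    {A B C D E : Phase N → ℝ} (hA : SmoothNear A z) (hB : SmoothNear B z) (hC : SmoothNear C z)
    (hD : SmoothNear D z) (hE : SmoothNear E z) :
    nambuBracket T (nambuBracket T A B C) D E z =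
        nambuBracket T (nambuBracket T A D E) B C z
          + nambuBracket T A (nambuBracket T B D E) C z
          + nambuBracket T A B (nambuBracket T C D E) z := by
  obtain ⟨A', hA', eA⟩ := hA.exists_contDiff
  obtain ⟨B', hB', eB⟩ := hB.exists_contDiff
  obtain ⟨C', hC', eC⟩ := hC.exists_contDiff
  obtain ⟨D', hD', eD⟩ := hD.exists_contDiff
  obtain ⟨E', hE', eE⟩ := hE.exists_contDiff
  have h := hT.fundamental A' B' C' D' E' hA'.contDiffOn hB'.contDiffOn hC'.contDiffOn
    hD'.contDiffOn hE'.contDiffOn z hz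
  rwa [(nambuBracket_congr (nambuBracket_congr eA eB eC) eD eE).self_of_nhds,
    (nambuBracket_congr (nambuBracket_congr eA eD eE) eB eC).self_of_nhds,
    (nambuBracket_congr eA (nambuBracket_congr eB eD eE) eC).self_of_nhds,
    (nambuBracket_congr eA eB (nambuBracket_congr eC eD eE)).self_of_nhds] at h

/-- By the fundamental identity X_{D,E} acts as a derivation on {A, B, ·}. Its commutator with
X_{A,B} therefore consists of the terms containing {A, D, E} and {B, D, E}, which enter only through
their differentials. -/
theorem lieBracket_nambuField (hT : IsNambuTensor U T) (hU : IsOpen U) {z : Phase N} (hz : z ∈ U)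
    {A B D E : Phase N → ℝ} (hA : SmoothNear A z) (hB : SmoothNear B z)
    (hD : SmoothNear D z) (hE : SmoothNear E z)
    (h1 : fderiv ℝ (nambuBracket T D E A) z = 0) (h2 : fderiv ℝ (nambuBracket T D E B) z = 0) :
    VectorField.lieBracket ℝ (nambuField T D E) (nambuField T A B) z = 0 := by
  have hrot : ∀ A B C : Phase N → ℝ, nambuBracket T B C A =ᶠ[𝓝 z] nambuBracket T A B C := by
    intro A B C
    filter_upwards [hU.mem_nhds hz] with w hw using hT.nambuBracket_rotate hw A B C
  funext k
  have hcomp : ∀ V : Phase N → Phase N, DifferentiableAt ℝ V z → ∀ v,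
      fderiv ℝ V z v k = fderiv ℝ (fun w => V w k) z v := by
    intro V hV v
    have := (ContinuousLinearMap.proj (R := ℝ) (φ := fun _ : Fin N => ℝ) k).hasFDerivAt.comp z
      hV.hasFDerivAt
    exact congrArg (fun l : Phase N →L[ℝ] ℝ => l v) this.fderiv.symm
  have hk := smoothNear_coord k z
  have hF := hT.fundamental_near hz hA hB hk hD hE
  change fderiv ℝ (nambuField T A B) z (nambuField T D E z) k -
    fderiv ℝ (nambuField T D E) z (nambuField T A B z) k = 0
  rw [hcomp _ (hT.smoothNear_nambuField hU hz hA hB).differentiableAt,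
    hcomp _ (hT.smoothNear_nambuField hU hz hD hE).differentiableAt, nambuField_apply,
    nambuField_apply, ← nambuBracket_eq_fderiv, ← nambuBracket_eq_fderiv,
    hT.nambuBracket_rotate hz (nambuBracket T A B fun z => z k) D E, hF,
    (nambuBracket_congr (EventuallyEq.refl _ A) (EventuallyEq.refl _ B)
      (hrot (fun z => z k) D E).symm).self_of_nhds,
    nambuBracket_eq_triForm _ (nambuBracket T A D E),
    nambuBracket_eq_triForm _ A (nambuBracket T B D E),
    ← (hrot A D E).fderiv_eq, ← (hrot B D E).fderiv_eq, h1, h2,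
    triForm_zero, hT.triForm_swap_left hz 0, triForm_zero]
  ring

end IsNambuTensor

end Brackets

/-! ### Levi-Civita symbols on three chosen slots. -/

section LeviCivita

variable {N : ℕ}

/-- The Levi-Civita symbol on the indices `σ 0, σ 1, σ 2`, zero if another index occurs. -/
def leviCivitaOn (σ : Fin 3 → Fin N) (i j k : Fin N) : ℝ :=
  let row : Fin N → Fin 3 → ℝ := fun i a => if σ a = i then 1 else 0
  Matrix.det (Matrix.of ![row i, row j, row k])

theorem leviCivitaOn_swap_left (σ : Fin 3 → Fin N) (i j k : Fin N) :
    leviCivitaOn σ j i k = -leviCivitaOn σ i j k := by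
  simp only [leviCivitaOn, Matrix.det_fin_three, Matrix.of_apply, Matrix.cons_val]
  ring

theorem leviCivitaOn_swap_right (σ : Fin 3 → Fin N) (i j k : Fin N) :
    leviCivitaOn σ i k j = -leviCivitaOn σ i j k := by
  simp only [leviCivitaOn, Matrix.det_fin_three, Matrix.of_apply, Matrix.cons_val]
  ring

theorem leviCivitaOn_eq_zero {σ : Fin 3 → Fin N} {i : Fin N} (hi : i ∉ Set.range σ)
    (j k : Fin N) : leviCivitaOn σ i j k = 0 := by
  have h : ∀ a, σ a ≠ i := fun a ha => hi ⟨a, ha⟩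
  simp [leviCivitaOn, Matrix.det_fin_three, h]

theorem leviCivitaOn_self {σ : Fin 3 → Fin N} (hσ : Function.Injective σ) :
    leviCivitaOn σ (σ 0) (σ 1) (σ 2) = 1 := by
  simp [leviCivitaOn, Matrix.det_fin_three, hσ.eq_iff]

theorem leviCivita_eq (hN : 3 ≤ N) (i j k : Fin N) :
    leviCivita N i j k =
      leviCivitaOn ![⟨0, by omega⟩, ⟨1, by omega⟩, ⟨N - 1, by omega⟩] i j k := by
  have hrow : ∀ i : Fin N, (![if i.val = 0 then 1 else 0, if i.val = 1 then 1 else 0,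
      if i.val + 1 = N then 1 else 0] : Fin 3 → ℝ) = fun a =>
      if (![⟨0, by omega⟩, ⟨1, by omega⟩, ⟨N - 1, by omega⟩] : Fin 3 → Fin N) a = i
        then 1 else 0 := by
    intro i
    funext a
    fin_cases a
    · simp [Fin.ext_iff, eq_comm]
    · simp [Fin.ext_iff, eq_comm]
    · simp only [Fin.ext_iff, Fin.reduceFinMk, Matrix.cons_val]
      congr 1
      apply propext
      omega
  simp only [leviCivita, leviCivitaOn, hrow]

/-- An antisymmetric trivalent tensor on three indices is determined by one component. -/
theorem antisymm_ext {t s : Fin 3 → Fin 3 → Fin 3 → ℝ} (t1 : ∀ a b c, t b a c = -t a b c)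
    (t2 : ∀ a b c, t a c b = -t a b c) (s1 : ∀ a b c, s b a c = -s a b c)
    (s2 : ∀ a b c, s a c b = -s a b c) (h : t 0 1 2 = s 0 1 2) (a b c : Fin 3) :
    t a b c = s a b c := by
  have d1 : ∀ a c, t a a c = s a a c := fun a c => by linarith [t1 a a c, s1 a a c]
  have d2 : ∀ a c, t a c c = s a c c := fun a c => by linarith [t2 a c c, s2 a c c]
  have d3 : ∀ a c, t a c a = s a c a := fun a c => by
    linarith [t1 a c a, s1 a c a, d2 c a]
  fin_cases a <;> fin_cases b <;> fin_cases c <;>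
    first
    | exact d1 _ _
    | exact d2 _ _
    | exact d3 _ _
    | (simp only [Fin.reduceFinMk, Fin.zero_eta, Fin.mk_one]
       linarith [t1 0 1 2, s1 0 1 2, t2 0 1 2, s2 0 1 2, t1 0 2 1, s1 0 2 1, t2 1 0 2, s2 1 0 2,
        t1 1 2 0, s1 1 2 0])

end LeviCivita

/-! ### Decomposability and canonical coordinates for Nambu tensors. -/

section NormalForm

variable {N : ℕ} {T : TriTensor N} {U : Set (Phase N)}

namespace IsNambuTensor

/-- The algebraic part of the fundamental identity. -/
theorem triForm_quad (hT : IsNambuTensor U T) (hU : IsOpen U) {z : Phase N} (hz : z ∈ U)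
    (α β γ δ ε : Phase N →L[ℝ] ℝ) :
    triForm T z α δ ε * triForm T z δ β γ + triForm T z β δ ε * triForm T z δ γ α +
      triForm T z γ δ ε * triForm T z δ α β = 0 := by
  have hs : ∀ α : Phase N →L[ℝ] ℝ, SmoothNear (fun w => α w) z := fun α =>
    .of_contDiff α.contDiff z
  have hd : ∀ (α : Phase N →L[ℝ] ℝ) w, fderiv ℝ (fun w => α w) w = α := fun α w => α.fderiv
  let D : Phase N → ℝ := fun w => δ w - δ z
  have hD : SmoothNear D z := (hs δ).sub (.const _ z)
  have hdD : ∀ w, fderiv ℝ D w = δ := fun w => (δ.hasFDerivAt.sub_const (δ z)).fderiv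
  have hDz : D z = 0 := sub_self _
  -- Q has zero differential at z, but {α, Q, ε} = 2 D {α, D, ε} has a differential there
  -- proportional to δ. Put in the fourth slot of the fundamental identity, Q isolates the terms
  -- quadratic in the tensor.
  let Q : Phase N → ℝ := fun w => D w * D w
  have hQ : SmoothNear Q z := hD.mul hD
  have hdQ : ∀ w, fderiv ℝ Q w = (2 * D w) • δ := by
    intro w
    have h1 : HasFDerivAt D δ w := δ.hasFDerivAt.sub_const (δ z)
    have h2 : HasFDerivAt Q (D w • δ + D w • δ) w := h1.mul h1
    rw [h2.fderiv, ← add_smul, two_mul]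
  have hbr : ∀ α : Phase N →L[ℝ] ℝ,
      fderiv ℝ (nambuBracket T (fun w => α w) Q fun w => ε w) z =
        (2 * triForm T z α δ ε) • δ := by
    intro α
    have h1 : (nambuBracket T (fun w => α w) Q fun w => ε w) =ᶠ[𝓝 z]
        fun w => D w * (2 * nambuBracket T (fun w => α w) D (fun w => ε w) w) := by
      filter_upwards [hU.mem_nhds hz] with w hw
      rw [nambuBracket_eq_triForm, nambuBracket_eq_triForm, hdQ, hdD, hd, hd,
        hT.triForm_swap_left hw, triForm_smul, hT.triForm_swap_left hw]
      ring
    have h2 : HasFDerivAt D δ z := δ.hasFDerivAt.sub_const (δ z)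
    have h3 := (SmoothNear.mul (.const 2 z)
      (hT.smoothNear_nambuBracket hU hz (hs α) hD (hs ε))).differentiableAt.hasFDerivAt
    have h4 := HasFDerivAt.fderiv (f := fun w => D w *
      (2 * nambuBracket T (fun w => α w) D (fun w => ε w) w)) (h2.mul h3)
    rw [h1.fderiv_eq, h4, hDz, zero_smul, zero_add, nambuBracket_eq_triForm, hdD,
      hd, hd]
  have h := hT.fundamental_near hz (hs α) (hs β) (hs γ) hQ (hs ε)
  simp only [nambuBracket_eq_triForm T _ _ _ z, hbr, hdQ, hDz, mul_zero, zero_smul] at h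
  rw [hT.triForm_swap_left hz 0, triForm_zero, triForm_smul] at h
  simp only [ContinuousLinearMap.fderiv] at h
  have h2 := hT.triForm_rotate hz α ((2 * triForm T z β δ ε) • δ) γ
  have h3 := hT.triForm_rotate hz ((2 * triForm T z γ δ ε) • δ) α β
  rw [triForm_smul] at h2 h3
  rw [← h2, h3] at h
  linarith

/-- The wedge decomposition of a Nambu tensor: a contraction of it with `b` vanishes on pairs of
forms that annihilate the Hamiltonian vector field of `b` and `c`. -/
theorem triForm_eq_zero_of_quad (hT : IsNambuTensor U T) (hU : IsOpen U) {z : Phase N}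
    (hz : z ∈ U) {a b c β γ : Phase N →L[ℝ] ℝ} (h : triForm T z a b c = 1)
    (hβ : triForm T z β b c = 0) (hγ : triForm T z γ b c = 0) : triForm T z b β γ = 0 := by
  have := hT.triForm_quad hU hz a β γ b c
  rw [h, hβ, hγ] at this
  linarith

/-- The wedge decomposition of a Nambu tensor: it vanishes on forms that annihilate three
independent Hamiltonian vector fields. -/
theorem triForm_eq_zero_of_kernel (hT : IsNambuTensor U T) (hU : IsOpen U) {z : Phase N}
    (hz : z ∈ U) {a b c : Phase N →L[ℝ] ℝ} (h : triForm T z a b c = 1)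
    {β γ δ : Phase N →L[ℝ] ℝ} (hβ : triForm T z β b c = 0) (hβ' : triForm T z β c a = 0)
    (hγ : triForm T z γ b c = 0) (hγ' : triForm T z γ c a = 0) (hδ' : triForm T z δ c a = 0) :
    triForm T z δ β γ = 0 := by
  have hbca : triForm T z b c a = 1 := by rw [hT.triForm_rotate hz, h]
  -- Polarisation: the previous lemma applies to b and also to b + δ, because the hypotheses make
  -- the cross terms with δ vanish. Subtracting the two conclusions gives the claim.
  have hsum : ∀ ε : Phase N →L[ℝ] ℝ,
      triForm T z ε (b + δ) c = triForm T z ε b c + triForm T z ε δ c := fun ε => by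
    rw [← hT.triForm_rotate hz ε, triForm_add, hT.triForm_rotate hz ε, hT.triForm_rotate hz ε]
  have h1 : triForm T z a (b + δ) c = 1 := by
    rw [hsum, h, ← hT.triForm_rotate hz a δ c, hδ', add_zero]
  have h2 : ∀ ε, triForm T z ε b c = 0 → triForm T z ε c a = 0 →
      triForm T z ε (b + δ) c = 0 := fun ε h3 h4 => by
    rw [hsum, h3, zero_add, hT.triForm_rotate hz c ε δ]
    exact hT.triForm_eq_zero_of_quad hU hz hbca h4 hδ'
  have h3 := hT.triForm_eq_zero_of_quad hU hz h1 (h2 β hβ hβ') (h2 γ hγ hγ')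
  rwa [triForm_add, hT.triForm_eq_zero_of_quad hU hz h hβ hγ, zero_add] at h3

/-- Three functions with bracket `1` can be completed to coordinates in which the Nambu tensor is
the Levi-Civita symbol. -/
theorem exists_canonical_coordinates (hT : IsNambuTensor U T) (hU : IsOpen U) {p : Phase N}
    (hp : p ∈ U) {f : Fin 3 → Phase N → ℝ} (hf : ∀ a, SmoothNear (f a) p)
    (h1 : ∀ᶠ z in 𝓝 p, nambuBracket T (f 0) (f 1) (f 2) z = 1) {σ : Fin 3 → Fin N}
    (hσ : Function.Injective σ) :
    ∃ F : Fin N → Phase N → ℝ, (∀ i, SmoothNear (F i) p) ∧ (∀ a, F (σ a) = f a) ∧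
      (LinearIndependent ℝ fun i => fderiv ℝ (F i) p) ∧
      ∀ᶠ z in 𝓝 p, ∀ i j k, nambuBracket T (F i) (F j) (F k) z = leviCivitaOn σ i j k := by
  have hbr : ∀ᶠ z in 𝓝 p, ∀ a b c,
      nambuBracket T (f a) (f b) (f c) z = leviCivitaOn (id : Fin 3 → Fin 3) a b c := by
    filter_upwards [h1, hU.mem_nhds hp] with z hz hzU a b c
    refine antisymm_ext (t := fun a b c => nambuBracket T (f a) (f b) (f c) z)
      (fun a b c => hT.triForm_swap_left hzU _ _ _) (fun a b c => hT.triForm_swap_right hzU _ _ _)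
      (leviCivitaOn_swap_left _) (leviCivitaOn_swap_right _) ?_ a b c
    exact hz.trans (leviCivitaOn_self Function.injective_id).symm
  -- Indices are cyclic modulo 3; this choice makes the fields dual to f 0, f 1, f 2.
  let X : Fin 3 → Phase N → Phase N := fun a => nambuField T (f (a + 1)) (f (a + 2))
  have hX : ∀ a, SmoothNear (X a) p := fun a => hT.smoothNear_nambuField hU hp (hf _) (hf _)
  have hlc : ∀ a b : Fin 3, leviCivitaOn (id : Fin 3 → Fin 3) (a + 1) (a + 2) b =
      if a = b then 1 else 0 := by
    intro a b
    fin_cases a <;> fin_cases b <;> simp [leviCivitaOn, Matrix.det_fin_three]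
  have hfX : ∀ a b, fderiv ℝ (f b) p (X a p) = if a = b then 1 else 0 := by
    intro a b
    rw [← nambuBracket_eq_fderiv, hbr.self_of_nhds, hlc]
  have hcomm : ∀ a b, ∀ᶠ z in 𝓝 p, VectorField.lieBracket ℝ (X a) (X b) z = 0 := by
    intro a b
    filter_upwards [hbr.eventually_nhds, hU.mem_nhds hp,
      eventually_all.2 fun a => (hf a).eventually] with z hz hzU hfz
    have hconst : ∀ a b c, fderiv ℝ (nambuBracket T (f a) (f b) (f c)) z = 0 := by
      intro a b c
      have : nambuBracket T (f a) (f b) (f c) =ᶠ[𝓝 z] fun _ => leviCivitaOn id a b c := by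
        filter_upwards [hz] with w hw using hw a b c
      rw [this.fderiv_eq]
      exact fderiv_const_apply _
    exact hT.lieBracket_nambuField hU hzU (hfz _) (hfz _) (hfz _) (hfz _) (hconst _ _ _)
      (hconst _ _ _)
  have hind : LinearIndependent ℝ fun a => X a p := by
    rw [Fintype.linearIndependent_iff]
    intro c hc b
    have := congrArg (fderiv ℝ (f b) p) hc
    simpa [map_sum, hfX] using this
  have hdual : ∀ c : Fin 3 → ℝ, (∀ a, ∑ b, c b * fderiv ℝ (f b) p (X a p) = 0) → c = 0 := by
    intro c hc
    funext a
    simpa [hfX] using hc a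
  obtain ⟨F, hF, hFσ, hFX, hFi⟩ := exists_coordinates hσ hf hX hcomm hind hdual
  refine ⟨F, hF, hFσ, hFi, ?_⟩
  -- The added coordinates are first integrals of the X a, so their differentials satisfy the
  -- hypotheses of the wedge lemmas. The rest is multilinear algebra at each z: every component with
  -- an added index vanishes.
  have hker : ∀ᶠ z in 𝓝 p, ∀ i ∉ Set.range σ, ∀ a, fderiv ℝ (F i) z (X a z) = 0 := by
    simp only [eventually_all]
    exact fun i hi a => hFX a i hi
  filter_upwards [hbr, hker, hU.mem_nhds hp] with z hz hk hzU
  set τ := triForm T z with hτ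
  have hrot : ∀ α β γ, τ β γ α = τ α β γ := hT.triForm_rotate hzU
  have hf3 : ∀ a b, τ (fderiv ℝ (f (a + 1)) z) (fderiv ℝ (f (a + 2)) z) (fderiv ℝ (f b) z) =
      if a = b then 1 else 0 := fun a b => (hz _ _ _).trans (hlc a b)
  have hτ1 : ∀ a, τ (fderiv ℝ (f a) z) (fderiv ℝ (f (a + 1)) z) (fderiv ℝ (f (a + 2)) z) = 1 := by
    intro a
    rw [← hrot, hf3, if_pos rfl]
  have hk1 : ∀ i ∉ Set.range σ, ∀ a,
      τ (fderiv ℝ (F i) z) (fderiv ℝ (f (a + 1)) z) (fderiv ℝ (f (a + 2)) z) = 0 := by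
    intro i hi a
    have := hk i hi a
    rwa [← nambuBracket_eq_fderiv, nambuBracket_eq_triForm, ← hτ, hrot] at this
  have hk2 : ∀ i ∉ Set.range σ, ∀ b,
      τ (fderiv ℝ (F i) z) (fderiv ℝ (f b) z) (fderiv ℝ (f (b + 1)) z) = 0 := by
    intro i hi b
    have h2 := hk1 i hi (b + 2)
    have e1 : ∀ b : Fin 3, b + 2 + 1 = b := by decide
    have e2 : ∀ b : Fin 3, b + 2 + 2 = b + 1 := by decide
    rwa [e1, e2] at h2
  have hk3 : ∀ i ∉ Set.range σ, ∀ j ∉ Set.range σ, ∀ b,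
      τ (fderiv ℝ (f b) z) (fderiv ℝ (F i) z) (fderiv ℝ (F j) z) = 0 := by
    intro i hi j hj b
    have e1 : ∀ b : Fin 3, b + 2 + 1 = b := by decide
    have := hT.triForm_eq_zero_of_quad hU hzU (hτ1 (b + 2)) (hk1 i hi _) (hk1 j hj _)
    rwa [e1] at this
  have hk4 : ∀ i ∉ Set.range σ, ∀ j k,
      τ (fderiv ℝ (F i) z) (fderiv ℝ (F j) z) (fderiv ℝ (F k) z) = 0 := by
    intro i hi j k
    by_cases hj : j ∈ Set.range σ
    · obtain ⟨b, rfl⟩ := hj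
      rw [hFσ]
      by_cases hk : k ∈ Set.range σ
      · obtain ⟨c, rfl⟩ := hk
        rw [hFσ]
        have h3 : ∀ b c : Fin 3, c = b ∨ c = b + 1 ∨ b = c + 1 := by decide
        rcases h3 b c with rfl | rfl | rfl
        · linarith [hT.triForm_swap_right hzU (fderiv ℝ (F i) z) (fderiv ℝ (f c) z)
            (fderiv ℝ (f c) z)]
        · exact hk2 i hi b
        · rw [hτ, hT.triForm_swap_right hzU, ← hτ, hk2 i hi c, neg_zero]
      · rw [← hrot]
        exact hk3 k hk i hi b
    · by_cases hk : k ∈ Set.range σ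
      · obtain ⟨c, rfl⟩ := hk
        rw [hFσ, hrot]
        exact hk3 i hi j hj c
      · exact hT.triForm_eq_zero_of_kernel hU hzU (hτ1 0) (hk2 j hj 1) (hk2 j hj 2) (hk2 k hk 1)
          (hk2 k hk 2) (hk2 i hi 2)
  intro i j k
  rw [nambuBracket_eq_triForm, ← hτ]
  by_cases hi : i ∈ Set.range σ
  · by_cases hj : j ∈ Set.range σ
    · by_cases hk : k ∈ Set.range σ
      · obtain ⟨a, rfl⟩ := hi
        obtain ⟨b, rfl⟩ := hj
        obtain ⟨c, rfl⟩ := hk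
        rw [hFσ, hFσ, hFσ]
        refine (hz a b c).trans ?_
        simp [leviCivitaOn, hσ.eq_iff]
      · rw [← hrot, ← hrot, hk4 k hk, ← neg_neg (leviCivitaOn _ _ _ _), ← leviCivitaOn_swap_right]
        rw [← leviCivitaOn_swap_left, leviCivitaOn_eq_zero hk]
    · rw [← hrot, hk4 j hj, ← neg_neg (leviCivitaOn _ _ _ _), ← leviCivitaOn_swap_left,
        leviCivitaOn_eq_zero hj, neg_zero]
  · rw [hk4 i hi, leviCivitaOn_eq_zero hi]

/-- If a Hamiltonian vector field `X_{B,C}` does not vanish at `p`, some function `A` satisfies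
`{A, B, C} = 1` near `p`. -/
theorem exists_conjugate (hT : IsNambuTensor U T) (hU : IsOpen U) {p : Phase N}
    (hp : p ∈ U) {B C : Phase N → ℝ} (hB : SmoothNear B p) (hC : SmoothNear C p)
    (hX : nambuField T B C p ≠ 0) :
    ∃ A : Phase N → ℝ, SmoothNear A p ∧ ∀ᶠ z in 𝓝 p, nambuBracket T A B C z = 1 := by
  have hXi : LinearIndependent ℝ fun _ : Unit => nambuField T B C p :=
    LinearIndependent.of_subsingleton () hX
  obtain ⟨g, hg, -, -, hgX⟩ := exists_straighten (X := fun _ : Unit => nambuField T B C) (p := p)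
    Finset.univ (fun _ _ => hT.smoothNear_nambuField hU hp hB hC)
    (fun _ _ _ _ => Eventually.of_forall fun z => by
      rw [VectorField.lieBracket_self]; rfl)
    (by simpa [linearIndepOn_univ_iff] using hXi)
  obtain ⟨k, hk⟩ := Function.ne_iff.1 hX
  let L : Phase N →L[ℝ] ℝ := (nambuField T B C p k)⁻¹ • ContinuousLinearMap.proj k
  have hL : L (nambuField T B C p) = 1 := inv_mul_cancel₀ hk
  refine ⟨fun z => L (g z), SmoothNear.comp (g := L) (.of_contDiff L.contDiff _) hg, ?_⟩
  filter_upwards [hg, hgX () (Finset.mem_univ _), hU.mem_nhds hp] with z h1 h2 h3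
  have h4 : fderiv ℝ (fun z => L (g z)) z = L.comp (fderiv ℝ g z) :=
    (L.hasFDerivAt.comp z (h1.differentiableAt (by simp)).hasFDerivAt).fderiv
  rw [← hT.nambuBracket_rotate h3, nambuBracket_eq_fderiv, h4, ContinuousLinearMap.comp_apply, h2,
    hL]

end IsNambuTensor

end NormalForm

/-! ### Poisson brackets generated by a Nambu bracket. -/

section Generated

variable {N : ℕ} {T : TriTensor N} {U : Set (Phase N)}

theorem poissonBracket_coord (J : BiTensor N) (i j : Fin N) (z : Phase N) :
    poissonBracket J (fun z => z i) (fun z => z j) z = J z i j := by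
  simp [poissonBracket, pderiv_coord]

theorem nambuBracket_coord (T : TriTensor N) (i j : Fin N) (C : Phase N → ℝ) (z : Phase N) :
    nambuBracket T (fun z => z i) (fun z => z j) C z = ∑ k, T z i j k * pderiv k C z := by
  simp [nambuBracket, pderiv_coord, Finset.sum_ite_irrel]

theorem nambuBracket_coord₃ (T : TriTensor N) (i j k : Fin N) (z : Phase N) :
    nambuBracket T (fun z => z i) (fun z => z j) (fun z => z k) z = T z i j k := by
  simp [nambuBracket_coord, pderiv_coord]

namespace IsNambuTensor

theorem ne_of_ne_zero (hT : IsNambuTensor U T) {z : Phase N} (hz : z ∈ U) {i j k : Fin N}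
    (h : T z i j k ≠ 0) : i ≠ j ∧ j ≠ k ∧ i ≠ k := by
  refine ⟨?_, ?_, ?_⟩ <;> rintro rfl <;> apply h
  · linarith [hT.antisymm_left z hz i i k]
  · linarith [hT.antisymm_right z hz i j j]
  · have h1 := hT.antisymm_left z hz i j i
    have h2 := hT.antisymm_right z hz j i i
    linarith

theorem three_le (hT : IsNambuTensor U T) {z : Phase N} (hz : z ∈ U) {i j k : Fin N}
    (h : T z i j k ≠ 0) : 3 ≤ N := by
  obtain ⟨h1, h2, h3⟩ := hT.ne_of_ne_zero hz h
  simp only [ne_eq, Fin.ext_iff] at h1 h2 h3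
  omega

/-- Canonical coordinates for a Nambu tensor, with a prescribed last coordinate. -/
theorem exists_coordinates_of_ne_zero (hT : IsNambuTensor U T) (hU : IsOpen U) {p : Phase N}
    (hp : p ∈ U) {C : Phase N → ℝ} (hC : SmoothNear C p) {i j : Fin N}
    (hne : nambuBracket T (fun z => z i) (fun z => z j) C p ≠ 0) {σ : Fin 3 → Fin N}
    (hσ : Function.Injective σ) :
    ∃ F : Fin N → Phase N → ℝ, (∀ i, SmoothNear (F i) p) ∧ F (σ 2) = C ∧
      (LinearIndependent ℝ fun i => fderiv ℝ (F i) p) ∧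
      ∀ᶠ z in 𝓝 p, ∀ i j k, nambuBracket T (F i) (F j) (F k) z = leviCivitaOn σ i j k := by
  have hX : nambuField T (fun z => z j) C p ≠ 0 := by
    intro h
    rw [← hT.nambuBracket_rotate hp, nambuBracket_eq_fderiv, h, map_zero] at hne
    exact hne rfl
  obtain ⟨A, hA, hA1⟩ := hT.exists_conjugate hU hp (smoothNear_coord j p) hC hX
  obtain ⟨F, h1, h2, h3, h4⟩ := hT.exists_canonical_coordinates hU hp
    (f := ![A, fun z => z j, C]) (fun a => by
      fin_cases a
      exacts [hA, smoothNear_coord j p, hC]) hA1 hσ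
  exact ⟨F, h1, h2 2, h3, h4⟩

end IsNambuTensor

/-- Testing on the coordinate functions gives J_ij = ∑ T_ijk ∂_k C, which carries the identity over
to functions that are not smooth on all of U, such as coordinates constructed only near a point. -/
theorem poissonBracket_eq_of_generatedBy {J : BiTensor N} {C : Phase N → ℝ}
    (h : GeneratedBy U J T C) {z : Phase N} (hz : z ∈ U) (A B : Phase N → ℝ) :
    poissonBracket J A B z = nambuBracket T A B C z := by
  have hobs : ∀ i : Fin N, IsObservable U fun z : Phase N => z i :=
    fun i => (contDiff_apply ℝ ℝ i).contDiffOn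
  have hJ : ∀ i j, J z i j = ∑ k, T z i j k * pderiv k C z := fun i j => by
    rw [← poissonBracket_coord J, h _ _ (hobs i) (hobs j) z hz, nambuBracket_coord]
  simp only [poissonBracket, nambuBracket, hJ, Finset.sum_mul]
  refine Finset.sum_congr rfl fun i _ => Finset.sum_congr rfl fun j _ =>
    Finset.sum_congr rfl fun k _ => ?_
  ring

/-- Used with C as the last coordinate: the Poisson matrix is then {h_i, h_j, h_N}, so its normal
form is read off from that of the Nambu tensor. -/
theorem leviCivita_last {l : Fin N} (hl : l.val + 1 = N) (hN : 3 ≤ N) (i j : Fin N) :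
    leviCivita N i j l = canonicalPoisson N i j := by
  have h0 : ¬ l.val = 0 := by omega
  have h1 : ¬ l.val = 1 := by omega
  simp only [leviCivita, canonicalPoisson, Matrix.det_fin_three, Matrix.of_apply, Matrix.cons_val,
    hl, h0, h1, if_true, if_false]
  split_ifs <;> first | omega | norm_num

theorem injective_canonicalSlots (hN : 3 ≤ N) :
    Function.Injective
      (![⟨0, by omega⟩, ⟨1, by omega⟩, ⟨N - 1, by omega⟩] : Fin 3 → Fin N) := by
  intro a b hab
  fin_cases a <;> fin_cases b <;> simp [Fin.ext_iff] at hab ⊢ <;> omega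

/-- The local normal form of a Poisson tensor of rank two generated by a Nambu tensor. -/
theorem exists_normal_form_of_generatedBy (hU : IsOpen U) (hT : IsNambuTensor U T)
    {J : BiTensor N} {C : Phase N → ℝ} (hC : IsObservable U C) (hJ : GeneratedBy U J T C)
    {z₀ : Phase N} (hz₀ : z₀ ∈ U) (hne : J z₀ ≠ 0) :
    ∃ h : OpenPartialHomeomorph (Phase N) (Phase N),
      IsCoordChange h ∧ z₀ ∈ h.source ∧ h.source ⊆ U ∧
      (∀ x ∈ h.target, ∀ l : Fin N, l.val + 1 = N → C (h.symm x) = x l) ∧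
      (∀ x ∈ h.target, pushPoisson h J x = canonicalPoisson N) ∧
      (∀ x ∈ h.target, ∀ i j k : Fin N, pushNambu h T x i j k = leviCivita N i j k) := by
  obtain ⟨i, j, hij⟩ : ∃ i j, J z₀ i j ≠ 0 := by
    by_contra! hcon
    exact hne (Matrix.ext hcon)
  have hne' : nambuBracket T (fun z => z i) (fun z => z j) C z₀ ≠ 0 := by
    rwa [← poissonBracket_eq_of_generatedBy hJ hz₀, poissonBracket_coord]
  -- A nonzero J forces a nonzero component of T, which needs three distinct indices.
  have hN : 3 ≤ N := by
    rw [nambuBracket_coord] at hne'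
    obtain ⟨k, -, hk⟩ := Finset.exists_ne_zero_of_sum_ne_zero hne'
    exact hT.three_le hz₀ (left_ne_zero_of_mul hk)
  obtain ⟨F, hF, hFC, hFi, hFT⟩ := hT.exists_coordinates_of_ne_zero hU hz₀
    (SmoothNear.of_contDiffOn hC hU hz₀) hne' (injective_canonicalSlots hN)
  obtain ⟨h, hh, hz, hs, hhF⟩ := exists_isCoordChange hF hFi (inter_mem (hU.mem_nhds hz₀) hFT)
  have hfun : ∀ i, (fun z => h z i) = F i := fun i => funext fun z => hhF z i
  have hlast : ∀ l : Fin N, l.val + 1 = N → F l = C := by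
    intro l hl
    rw [← hFC]
    congr 1
    apply Fin.ext
    change l.val = N - 1
    omega
  have hnb : ∀ x ∈ h.target, ∀ i j k, nambuBracket T (F i) (F j) (F k) (h.symm x) =
      leviCivita N i j k := by
    intro x hx i j k
    rw [leviCivita_eq hN]
    exact (hs (h.map_target hx)).2 i j k
  refine ⟨h, hh, hz, fun z hz => (hs hz).1, fun x hx l hl => ?_, fun x hx => ?_,
    fun x hx i j k => ?_⟩
  · rw [← hlast l hl, ← hhF, h.right_inv hx]
  · ext i j
    have hl : (⟨N - 1, by omega⟩ : Fin N).val + 1 = N := by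
      change N - 1 + 1 = N
      omega
    rw [pushPoisson, Matrix.of_apply, poissonBracket_eq_of_generatedBy hJ
      (hs (h.map_target hx)).1, hfun, hfun, ← hlast _ hl, hnb x hx, leviCivita_last hl hN]
  · simp only [pushNambu, hfun, hnb x hx]

end Generated

/-! ### The constant model and the uniqueness of the Nambu class. -/

section Model

variable {N : ℕ}

theorem pderiv_comm {A : Phase N → ℝ} {z : Phase N} (hA : ContDiffAt ℝ ∞ A z) (i j : Fin N) :
    pderiv i (pderiv j A) z = pderiv j (pderiv i A) z := by
  have h1 : DifferentiableAt ℝ (fderiv ℝ A) z :=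
    (hA.fderiv_right (m := ∞) (by simp)).differentiableAt (by simp)
  have h2 : ∀ i j : Fin N, pderiv i (pderiv j A) z =
      fderiv ℝ (fderiv ℝ A) z (Pi.single i 1) (Pi.single j 1) := by
    intro i j
    have h3 := h1.hasFDerivAt.clm_apply (hasFDerivAt_const (Pi.single j 1 : Phase N) z)
    have h4 : fderiv ℝ (pderiv j A) z = _ := h3.fderiv
    rw [pderiv, h4]
    simp
  rw [h2, h2]
  exact (hA.isSymmSndFDerivAt (by
    rw [minSmoothness_of_isRCLikeNormedField]; exact ENat.LEInfty.out)).eq _ _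

/-- The determinant of three vectors. -/
def det₃ (u v w : Fin 3 → ℝ) : ℝ :=
  u 0 * v 1 * w 2 - u 0 * v 2 * w 1 - u 1 * v 0 * w 2 + u 1 * v 2 * w 0 + u 2 * v 0 * w 1 -
    u 2 * v 1 * w 0

/-- The constant Nambu tensor given by the Levi-Civita symbol. -/
def leviCivitaTensor (σ : Fin 3 → Fin N) : TriTensor N := fun _ => leviCivitaOn σ

theorem nambuBracket_leviCivitaTensor (σ : Fin 3 → Fin N) (A B C : Phase N → ℝ) (z : Phase N) :
    nambuBracket (leviCivitaTensor σ) A B C z =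
      det₃ (fun a => pderiv (σ a) A z) (fun a => pderiv (σ a) B z) fun a => pderiv (σ a) C z := by
  have h : ∀ i j k, leviCivitaOn σ i j k = det₃ (fun a => if σ a = i then 1 else 0)
      (fun a => if σ a = j then 1 else 0) (fun a => if σ a = k then 1 else 0) := by
    intro i j k
    simp only [leviCivitaOn, det₃, Matrix.det_fin_three, Matrix.of_apply, Matrix.cons_val]
  simp only [nambuBracket, leviCivitaTensor, h, det₃, sub_mul, add_mul, Finset.sum_add_distrib,
    Finset.sum_sub_distrib, ite_mul, mul_ite, one_mul, zero_mul, mul_one, mul_zero,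
    Finset.sum_ite_eq, Finset.mem_univ, if_true]

theorem pderiv_det₃ {u v w : Fin 3 → Phase N → ℝ} {z : Phase N}
    (hu : ∀ a, DifferentiableAt ℝ (u a) z) (hv : ∀ a, DifferentiableAt ℝ (v a) z)
    (hw : ∀ a, DifferentiableAt ℝ (w a) z) (i : Fin N) :
    pderiv i (fun z => det₃ (fun a => u a z) (fun a => v a z) fun a => w a z) z =
      det₃ (fun a => pderiv i (u a) z) (fun a => v a z) (fun a => w a z) +
      det₃ (fun a => u a z) (fun a => pderiv i (v a) z) (fun a => w a z) +
      det₃ (fun a => u a z) (fun a => v a z) (fun a => pderiv i (w a) z) := by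
  have hp : ∀ a b c, HasFDerivAt (fun z => u a z * v b z * w c z) _ z := fun a b c =>
    ((hu a).hasFDerivAt.mul (hv b).hasFDerivAt).mul (hw c).hasFDerivAt
  have h := (((((hp 0 1 2).sub (hp 0 2 1)).sub (hp 1 0 2)).add (hp 1 2 0)).add (hp 2 0 1)).sub
    (hp 2 1 0)
  have h' : HasFDerivAt (fun z => det₃ (fun a => u a z) (fun a => v a z) fun a => w a z) _ z := h
  rw [pderiv, h'.fderiv]
  simp only [pderiv, det₃, _root_.add_apply, _root_.sub_apply, _root_.smul_apply, smul_eq_mul]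
  simp
  ring

/-- By the product rule both sides are polynomials in first and second derivatives at z. Once mixed
derivatives are put in a fixed order, the second derivatives of D and E, present only on the right,
cancel, and the identity is a polynomial one. -/
theorem isNambuTensor_leviCivitaTensor (σ : Fin 3 → Fin N) :
    IsNambuTensor Set.univ (leviCivitaTensor σ) where
  smooth i j k := contDiffOn_const
  antisymm_left _ _ i j k := leviCivitaOn_swap_left σ i j k
  antisymm_right _ _ i j k := leviCivitaOn_swap_right σ i j k
  fundamental A B C D E hA hB hC hD hE z _ := by
    have hs : ∀ {A : Phase N → ℝ}, IsObservable Set.univ A → SmoothNear A z := fun hA =>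
      .of_contDiffOn hA isOpen_univ (Set.mem_univ z)
    have hd : ∀ {A B C : Phase N → ℝ}, IsObservable Set.univ A → IsObservable Set.univ B →
        IsObservable Set.univ C → ∀ i,
        pderiv i (nambuBracket (leviCivitaTensor σ) A B C) z =
          det₃ (fun a => pderiv i (pderiv (σ a) A) z) (fun a => pderiv (σ a) B z)
              (fun a => pderiv (σ a) C z) +
            det₃ (fun a => pderiv (σ a) A z) (fun a => pderiv i (pderiv (σ a) B) z)
              (fun a => pderiv (σ a) C z) +
            det₃ (fun a => pderiv (σ a) A z) (fun a => pderiv (σ a) B z)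
              (fun a => pderiv i (pderiv (σ a) C) z) := by
      intro A B C hA hB hC i
      rw [show nambuBracket (leviCivitaTensor σ) A B C = _ from
        funext (nambuBracket_leviCivitaTensor σ A B C)]
      exact pderiv_det₃ (fun a => ((hs hA).pderiv (σ a)).differentiableAt)
        (fun a => ((hs hB).pderiv (σ a)).differentiableAt)
        (fun a => ((hs hC).pderiv (σ a)).differentiableAt) i
    have hc : ∀ {A : Phase N → ℝ}, IsObservable Set.univ A → ∀ i j,
        pderiv i (pderiv j A) z = pderiv j (pderiv i A) z :=
      fun hA => pderiv_comm (hs hA).self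
    simp only [nambuBracket_leviCivitaTensor, hd hA hB hC, hd hA hD hE, hd hB hD hE, hd hC hD hE]
    simp only [det₃, hc hA (σ 1) (σ 0), hc hA (σ 2) (σ 0), hc hA (σ 2) (σ 1),
      hc hB (σ 1) (σ 0), hc hB (σ 2) (σ 0), hc hB (σ 2) (σ 1),
      hc hC (σ 1) (σ 0), hc hC (σ 2) (σ 0), hc hC (σ 2) (σ 1),
      hc hD (σ 1) (σ 0), hc hD (σ 2) (σ 0), hc hD (σ 2) (σ 1),
      hc hE (σ 1) (σ 0), hc hE (σ 2) (σ 0), hc hE (σ 2) (σ 1)]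
    ring

/-- The model Nambu bracket at the origin. -/
def modelNambu (hN : 3 ≤ N) : LocalNambu N where
  dom := Set.univ
  isOpen_dom := isOpen_univ
  base := 0
  base_mem := Set.mem_univ _
  tensor := leviCivitaTensor ![⟨0, by omega⟩, ⟨1, by omega⟩, ⟨N - 1, by omega⟩]
  isNambu := isNambuTensor_leviCivitaTensor _
  ne_zero := ⟨_, _, _, (leviCivitaOn_self (injective_canonicalSlots hN)).trans_ne one_ne_zero⟩

/-- Coordinates can be translated so that a given point becomes the origin. -/
theorem exists_isCoordChangeBetween {U : Set (Phase N)} {p : Phase N} {F : Fin N → Phase N → ℝ}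
    (hF : ∀ i, SmoothNear (F i) p) (hind : LinearIndependent ℝ fun i => fderiv ℝ (F i) p)
    (hU : U ∈ 𝓝 p) {s : Set (Phase N)} (hs : s ∈ 𝓝 p) :
    ∃ h : OpenPartialHomeomorph (Phase N) (Phase N),
      IsCoordChangeBetween U Set.univ p 0 h ∧ h.source ⊆ s ∧
      ∀ z i, fderiv ℝ (fun z => h z i) z = fderiv ℝ (F i) z := by
  have hd : ∀ z i, fderiv ℝ (fun z => F i z - F i p) z = fderiv ℝ (F i) z := fun z i =>
    fderiv_sub_const _
  obtain ⟨h, hh, hp, hsub, hhF⟩ := exists_isCoordChange (F := fun i z => F i z - F i p)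
    (fun i => (hF i).sub (.const _ p)) (by simpa only [hd] using hind) (inter_mem hU hs)
  refine ⟨h, ⟨hh, hp, fun z hz => (hsub hz).1, Set.subset_univ _, ?_⟩, fun z hz => (hsub hz).2,
    fun z i => ?_⟩
  · funext i
    rw [hhF, sub_self]
    rfl
  · simp only [hhF, hd]

theorem nambuEquiv_model (hN : 3 ≤ N) (a : LocalNambu N) : NambuEquiv a (modelNambu hN) := by
  obtain ⟨i, j, k, hijk⟩ := a.ne_zero
  have hnb : nambuBracket a.tensor (fun z => z i) (fun z => z j) (fun z => z k) a.base ≠ 0 := by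
    rwa [nambuBracket_coord₃]
  -- With no distinguished function given, the k-th coordinate plays the role of C, since {z_i, z_j,
  -- z_k} is the nonzero component.
  obtain ⟨F, hF, -, hFi, hFT⟩ := a.isNambu.exists_coordinates_of_ne_zero a.isOpen_dom a.base_mem
    (smoothNear_coord k _) hnb (injective_canonicalSlots hN)
  obtain ⟨h, hh, hs, hhF⟩ := exists_isCoordChangeBetween hF hFi
    (a.isOpen_dom.mem_nhds a.base_mem) hFT
  refine ⟨h, hh, fun x hx i j k => ?_⟩
  rw [pushNambu, nambuBracket_eq_triForm, hhF, hhF, hhF, ← nambuBracket_eq_triForm]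
  exact hs (h.map_target hx) i j k

theorem card_nambuClass (hN : 3 ≤ N) : Nat.card (NambuClass N) = 1 := by
  rw [Nat.card_eq_one_iff_exists]
  refine ⟨Quotient.mk _ (modelNambu hN), fun y => ?_⟩
  induction y using Quotient.inductionOn with
  | h a => exact Quotient.sound (nambuEquiv_model hN a)

end Model

/-! ### Conjugate functions from commuting fields. -/

section FirstIntegrals

theorem linearIndependent_of_pairing {κ V : Type*} [Fintype κ] [AddCommGroup V] [Module ℝ V]
    {x : κ → V} (l : κ → Module.Dual ℝ V) (h1 : ∀ i, l i (x i) ≠ 0)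
    (h2 : ∀ i j, i ≠ j → l i (x j) = 0) : LinearIndependent ℝ x := by
  rw [Fintype.linearIndependent_iff]
  intro c hc i
  have h := congrArg (l i) hc
  rw [map_sum, map_zero, Finset.sum_eq_single i (fun j _ hj => by
    rw [map_smul, h2 i j hj.symm, smul_zero]) (by simp), map_smul, smul_eq_mul] at h
  exact (mul_eq_zero.1 h).resolve_right (h1 i)

/-- Among commuting independent vector fields, one can be given a conjugate function that is a first
integral of the others. -/
theorem exists_conjugate_first_integral {E : Type u} [NormedAddCommGroup E] [NormedSpace ℝ E]
    [FiniteDimensional ℝ E] {κ : Type*} [Fintype κ] [DecidableEq κ] {X : κ → E → E} {p : E}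
    (hX : ∀ i, SmoothNear (X i) p)
    (hcomm : ∀ i j, ∀ᶠ z in 𝓝 p, VectorField.lieBracket ℝ (X i) (X j) z = 0)
    (hind : LinearIndependent ℝ fun i => X i p) (a : κ) :
    ∃ G : E → ℝ, SmoothNear G p ∧
      ∀ᶠ z in 𝓝 p, ∀ i, fderiv ℝ G z (X i z) = if i = a then 1 else 0 := by
  obtain ⟨g, hg, -, -, hgX⟩ := exists_straighten Finset.univ (fun i _ => hX i)
    (fun i _ j _ => hcomm i j) (by simpa [linearIndepOn_univ_iff] using hind)
  -- The form dual to X a p on the span of the values, extended to E. Composed with the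
  -- straightening map, it keeps these constant pairings near p.
  obtain ⟨l, hl⟩ : ∃ l : Module.Dual ℝ E, ∀ i, l (X i p) = if i = a then 1 else 0 := by
    obtain ⟨l, hl⟩ := LinearMap.exists_extend ((Module.Basis.span hind).constr ℝ
      fun i => if i = a then (1 : ℝ) else 0)
    refine ⟨l, fun i => ?_⟩
    have h1 := congrArg (fun f => f (Module.Basis.span hind i)) hl
    rw [Module.Basis.constr_basis, LinearMap.comp_apply, Submodule.subtype_apply,
      Module.Basis.span_apply] at h1
    exact h1
  let L : E →L[ℝ] ℝ := LinearMap.toContinuousLinearMap l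
  refine ⟨fun z => L (g z), SmoothNear.comp (g := L) (.of_contDiff L.contDiff _) hg, ?_⟩
  filter_upwards [hg, eventually_all.2 fun i => hgX i (Finset.mem_univ i)] with z h1 h2 i
  have h4 : fderiv ℝ (fun z => L (g z)) z = L.comp (fderiv ℝ g z) :=
    (L.hasFDerivAt.comp z (h1.differentiableAt (by simp)).hasFDerivAt).fderiv
  rw [h4, ContinuousLinearMap.comp_apply, h2 i]
  exact hl i

end FirstIntegrals

/-! ### Poisson brackets and their Hamiltonian fields. -/

section Poisson

variable {N : ℕ}

/-- The Hamiltonian vector field of a function for a Poisson bracket. -/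
def poissonField (J : BiTensor N) (A : Phase N → ℝ) (z : Phase N) : Phase N :=
  fun k => ∑ i, J z i k * pderiv i A z

theorem poissonBracket_eq_fderiv (J : BiTensor N) (A B : Phase N → ℝ) (z : Phase N) :
    poissonBracket J A B z = fderiv ℝ B z (poissonField J A z) := by
  rw [fderiv_apply_eq_sum]
  simp only [poissonBracket, poissonField, Finset.sum_mul]
  exact Finset.sum_comm

variable {J : BiTensor N} {U : Set (Phase N)}

theorem poissonField_apply (A : Phase N → ℝ) (k : Fin N) :
    (fun z => poissonField J A z k) = poissonBracket J A fun z => z k := by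
  funext z
  rw [poissonBracket_eq_fderiv, fderiv_coord]
  rfl

theorem poissonBracket_congr_fderiv {A A' B B' : Phase N → ℝ} {z : Phase N}
    (hA : fderiv ℝ A' z = fderiv ℝ A z) (hB : fderiv ℝ B' z = fderiv ℝ B z) :
    poissonBracket J A' B' z = poissonBracket J A B z := by
  simp only [poissonBracket, pderiv, hA, hB]

theorem poissonBracket_congr {A A' B B' : Phase N → ℝ} {z : Phase N} (hA : A' =ᶠ[𝓝 z] A)
    (hB : B' =ᶠ[𝓝 z] B) : poissonBracket J A' B' =ᶠ[𝓝 z] poissonBracket J A B := by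
  filter_upwards [hA.eventually_nhds, hB.eventually_nhds] with w h1 h2
  exact poissonBracket_congr_fderiv (EventuallyEq.fderiv_eq h1) (EventuallyEq.fderiv_eq h2)

theorem poissonBracket_eq_zero {A B : Phase N → ℝ} {z : Phase N} (hA : fderiv ℝ A z = 0) :
    poissonBracket J A B z = 0 := by
  simp [poissonBracket, pderiv, hA]

namespace IsPoissonTensor

theorem smoothNear (hJ : IsPoissonTensor U J) (hU : IsOpen U) {z : Phase N} (hz : z ∈ U)
    (i j : Fin N) : SmoothNear (fun z => J z i j) z :=
  .of_contDiffOn (hJ.smooth i j) hU hz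

theorem poissonBracket_swap (hJ : IsPoissonTensor U J) {z : Phase N} (hz : z ∈ U)
    (A B : Phase N → ℝ) : poissonBracket J B A z = -poissonBracket J A B z := by
  simp only [poissonBracket, ← Finset.sum_neg_distrib]
  rw [Finset.sum_comm]
  refine Finset.sum_congr rfl fun i _ => Finset.sum_congr rfl fun j _ => ?_
  rw [hJ.antisymm z hz i j]
  ring

theorem smoothNear_poissonField (hJ : IsPoissonTensor U J) (hU : IsOpen U) {z : Phase N}
    (hz : z ∈ U) {A : Phase N → ℝ} (hA : SmoothNear A z) : SmoothNear (poissonField J A) z :=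
  .pi fun k => .sum fun i _ => (hJ.smoothNear hU hz i k).mul (hA.pderiv i)

/-- The Jacobi identity holds for functions that are smooth near a point. -/
theorem jacobi_near (hJ : IsPoissonTensor U J) {z : Phase N} (hz : z ∈ U)
    {A B D : Phase N → ℝ} (hA : SmoothNear A z) (hB : SmoothNear B z) (hD : SmoothNear D z) :
    poissonBracket J (poissonBracket J A B) D z
        + poissonBracket J (poissonBracket J D A) B z
        + poissonBracket J (poissonBracket J B D) A z = 0 := by
  obtain ⟨A', hA', eA⟩ := hA.exists_contDiff
  obtain ⟨B', hB', eB⟩ := hB.exists_contDiff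
  obtain ⟨D', hD', eD⟩ := hD.exists_contDiff
  have h := hJ.jacobi A' B' D' hA'.contDiffOn hB'.contDiffOn hD'.contDiffOn z hz
  rwa [(poissonBracket_congr (poissonBracket_congr eA eB) eD).self_of_nhds,
    (poissonBracket_congr (poissonBracket_congr eD eA) eB).self_of_nhds,
    (poissonBracket_congr (poissonBracket_congr eB eD) eA).self_of_nhds] at h

/-- The Jacobi identity makes [X_A, X_B] the Hamiltonian field of {A, B}, which depends only on the
differential of {A, B}. -/
theorem lieBracket_poissonField (hJ : IsPoissonTensor U J) (hU : IsOpen U) {z : Phase N}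
    (hz : z ∈ U) {A B : Phase N → ℝ} (hA : SmoothNear A z) (hB : SmoothNear B z)
    (h : fderiv ℝ (poissonBracket J A B) z = 0) :
    VectorField.lieBracket ℝ (poissonField J A) (poissonField J B) z = 0 := by
  funext k
  have hcomp : ∀ V : Phase N → Phase N, DifferentiableAt ℝ V z → ∀ v,
      fderiv ℝ V z v k = fderiv ℝ (fun w => V w k) z v := by
    intro V hV v
    have := (ContinuousLinearMap.proj (R := ℝ) (φ := fun _ : Fin N => ℝ) k).hasFDerivAt.comp z
      hV.hasFDerivAt
    exact congrArg (fun l : Phase N →L[ℝ] ℝ => l v) this.fderiv.symm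
  have hF := hJ.jacobi_near hz hA hB (smoothNear_coord k z)
  have hswap : fderiv ℝ (poissonBracket J (fun z => z k) A) z =
      fderiv ℝ (fun w => -poissonBracket J A (fun z => z k) w) z := by
    apply EventuallyEq.fderiv_eq
    filter_upwards [hU.mem_nhds hz] with w hw using hJ.poissonBracket_swap hw _ _
  change fderiv ℝ (poissonField J B) z (poissonField J A z) k -
    fderiv ℝ (poissonField J A) z (poissonField J B z) k = 0
  rw [hcomp _ (hJ.smoothNear_poissonField hU hz hA).differentiableAt,
    hcomp _ (hJ.smoothNear_poissonField hU hz hB).differentiableAt, poissonField_apply,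
    poissonField_apply, ← poissonBracket_eq_fderiv, ← poissonBracket_eq_fderiv]
  rw [poissonBracket_eq_zero h, zero_add, hJ.poissonBracket_swap hz B, poissonBracket_eq_fderiv,
    hswap, fderiv_fun_neg, neg_apply, ← poissonBracket_eq_fderiv, hJ.poissonBracket_swap hz A] at hF
  linarith

end IsPoissonTensor

end Poisson

/-! ### Canonical Poisson matrices with n conjugate pairs (2k, 2k + 1). -/

section Symplectic

/-- The index of the conjugate variable. -/
def conjIndex (i : ℕ) : ℕ := if i % 2 = 0 then i + 1 else i - 1

theorem conjIndex_lt {i n : ℕ} (h : i < 2 * n) : conjIndex i < 2 * n := by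
  unfold conjIndex
  split_ifs <;> omega

theorem conjIndex_conjIndex (i : ℕ) : conjIndex (conjIndex i) = i := by
  unfold conjIndex
  split_ifs <;> omega

theorem conjIndex_ne (i : ℕ) : conjIndex i ≠ i := by
  unfold conjIndex
  split_ifs <;> omega

/-- The entries of the canonical Poisson matrix with `n` pairs of conjugate variables. -/
def sympEntry (n i j : ℕ) : ℝ :=
  if i < 2 * n ∧ j = conjIndex i then (if i % 2 = 0 then 1 else -1) else 0

theorem sympEntry_ne_zero {n i : ℕ} (h : i < 2 * n) : sympEntry n i (conjIndex i) ≠ 0 := by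
  rw [sympEntry, if_pos ⟨h, rfl⟩]
  split_ifs <;> norm_num

theorem sympEntry_eq_zero {n i j : ℕ} (h : j ≠ conjIndex i) : sympEntry n i j = 0 :=
  if_neg fun h1 => h h1.2

theorem sympEntry_of_le {n i j : ℕ} (h : 2 * n ≤ i) : sympEntry n i j = 0 :=
  if_neg fun h1 => by omega

theorem sympEntry_swap (n i j : ℕ) : sympEntry n j i = -sympEntry n i j := by
  unfold sympEntry conjIndex
  split_ifs <;> first | omega | norm_num

theorem sympEntry_of_le_right {n i j : ℕ} (h : 2 * n ≤ j) : sympEntry n i j = 0 := by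
  rw [← neg_neg (sympEntry n i j), ← sympEntry_swap, sympEntry_of_le h, neg_zero]

theorem sympEntry_succ {n i j : ℕ} (h : i < 2 * n) : sympEntry (n + 1) i j = sympEntry n i j := by
  unfold sympEntry
  congr 1
  apply propext
  constructor <;> rintro ⟨h1, h2⟩ <;> exact ⟨by omega, h2⟩

/-- The canonical Poisson matrix with `n` pairs of conjugate variables. -/
def sympMatrix (N n : ℕ) : Matrix (Fin N) (Fin N) ℝ := Matrix.of fun i j => sympEntry n i j

variable {N : ℕ}

/-- The product with the transpose is a diagonal matrix with 2n ones, and over the reals this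
product has the same rank as the matrix. -/
theorem rank_sympMatrix {n : ℕ} (hn : 2 * n ≤ N) : (sympMatrix N n).rank = 2 * n := by
  have h : sympMatrix N n * (sympMatrix N n).transpose =
      Matrix.diagonal fun i : Fin N => if i.val < 2 * n then 1 else 0 := by
    ext i j
    rw [Matrix.mul_apply, Matrix.diagonal_apply]
    simp only [sympMatrix, Matrix.transpose_apply, Matrix.of_apply]
    by_cases hi : i.val < 2 * n
    · have hc : conjIndex i < N := (conjIndex_lt hi).trans_le hn
      rw [Finset.sum_eq_single ⟨conjIndex i, hc⟩ (fun k _ hk => by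
        rw [sympEntry_eq_zero (fun h => hk (Fin.ext h)), zero_mul]) (by simp)]
      by_cases hij : i = j
      · subst hij
        rw [if_pos rfl, if_pos hi, sympEntry, if_pos ⟨hi, rfl⟩]
        split_ifs <;> norm_num
      · rw [if_neg hij, sympEntry_eq_zero (i := j.val), mul_zero]
        intro h
        apply hij
        have := congrArg conjIndex h
        rw [conjIndex_conjIndex, conjIndex_conjIndex] at this
        exact Fin.ext this
    · rw [Finset.sum_eq_zero fun k _ => by rw [sympEntry_of_le (not_lt.1 hi), zero_mul], if_neg hi,
        ite_self]
  rw [← Matrix.rank_self_mul_transpose, h, Matrix.rank_diagonal]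
  have e : {i : Fin N // (if i.val < 2 * n then (1 : ℝ) else 0) ≠ 0} ≃ Fin (2 * n) :=
    { toFun := fun i => ⟨i.1.1, by simpa using i.2⟩
      invFun := fun i => ⟨⟨i.1, i.2.trans_le hn⟩, by simp⟩
      left_inv := fun _ => rfl
      right_inv := fun _ => rfl }
  rw [Fintype.card_congr e, Fintype.card_fin]

/-- An antisymmetric matrix whose first `2n` rows are canonical is canonical if it has the
canonical rank. -/
theorem eq_sympMatrix_of_rank_eq {M : Matrix (Fin N) (Fin N) ℝ} {n : ℕ}
    (hM : ∀ i j, M j i = -M i j) (h1 : ∀ i j : Fin N, i.val < 2 * n → M i j = sympEntry n i j)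
    (hr : M.rank = (sympMatrix N n).rank) : M = sympMatrix N n := by
  have h2 : ∀ i j : Fin N, j.val < 2 * n → M i j = sympEntry n i j := fun i j hj => by
    rw [hM j i, h1 j i hj, ← sympEntry_swap]
  -- The first 2n columns agree and the canonical matrix has no others, so its range lies in that of
  -- M. Equal ranks make the ranges equal, and vectors in the canonical range vanish from entry 2n
  -- on.
  have hle : LinearMap.range (sympMatrix N n).mulVecLin ≤ LinearMap.range M.mulVecLin := by
    rintro _ ⟨v, rfl⟩
    refine ⟨fun j => if j.val < 2 * n then v j else 0, ?_⟩
    ext i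
    simp only [Matrix.mulVecLin_apply, Matrix.mulVec, dotProduct, sympMatrix, Matrix.of_apply]
    refine Finset.sum_congr rfl fun j _ => ?_
    split_ifs with hj
    · rw [h2 i j hj]
    · rw [sympEntry_of_le_right (not_lt.1 hj), mul_zero, zero_mul]
  have heq := Submodule.eq_of_le_of_finrank_eq hle hr.symm
  ext a b
  change M a b = sympEntry n a b
  by_cases ha : a.val < 2 * n
  · exact h1 a b ha
  · rw [sympEntry_of_le (not_lt.1 ha)]
    have h3 : M.mulVecLin (Pi.single b 1) ∈ LinearMap.range (sympMatrix N n).mulVecLin := by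
      rw [heq]
      exact ⟨_, rfl⟩
    obtain ⟨v, hv⟩ := h3
    have h4 := congrFun hv a
    simp only [Matrix.mulVecLin_apply, Matrix.mulVec_single_one, Matrix.col_apply] at h4
    rw [← h4]
    simp only [Matrix.mulVec, dotProduct, sympMatrix, Matrix.of_apply]
    exact Finset.sum_eq_zero fun k _ => by rw [sympEntry_of_le (not_lt.1 ha), zero_mul]

end Symplectic

/-! ### Splitting off conjugate pairs. -/

section Darboux

variable {N : ℕ} {J : BiTensor N} {U : Set (Phase N)}

/-- `F` is a local coordinate system at `p` whose first `2n` coordinates are canonically conjugate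
and commute with all other coordinates. -/
structure IsPartialDarboux (J : BiTensor N) (p : Phase N) (n : ℕ) (F : Fin N → Phase N → ℝ) :
    Prop where
  le : 2 * n ≤ N
  smooth : ∀ i, SmoothNear (F i) p
  indep : LinearIndependent ℝ fun i => fderiv ℝ (F i) p
  bracket : ∀ᶠ z in 𝓝 p, ∀ i j : Fin N, i.val < 2 * n →
    poissonBracket J (F i) (F j) z = sympEntry n i j

theorem isPartialDarboux_zero (J : BiTensor N) (p : Phase N) :
    IsPartialDarboux J p 0 fun i z => z i where
  le := by omega
  smooth i := smoothNear_coord i p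
  indep := by
    simp only [fderiv_coord]
    rw [Fintype.linearIndependent_iff]
    intro c hc i
    have := congrArg (fun l : Phase N →L[ℝ] ℝ => l (Pi.single i 1)) hc
    simpa [Pi.single_apply] using this
  bracket := Eventually.of_forall fun _ i _ h => by omega

namespace IsPoissonTensor

/-- Canonically conjugate functions can be completed to coordinates by functions that commute with
them. -/
theorem exists_isPartialDarboux (hJ : IsPoissonTensor U J) (hU : IsOpen U) {p : Phase N}
    (hp : p ∈ U) {n : ℕ} (hn : 2 * n ≤ N) {f : ℕ → Phase N → ℝ}
    (hf : ∀ i < 2 * n, SmoothNear (f i) p)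
    (hbr : ∀ i < 2 * n, ∀ j < 2 * n, ∀ᶠ z in 𝓝 p,
      poissonBracket J (f i) (f j) z = sympEntry n i j) :
    ∃ F, IsPartialDarboux J p n F := by
  let κ := {i : Fin N // i.val < 2 * n}
  let X : κ → Phase N → Phase N := fun a => poissonField J (f a.1)
  -- The field of f a differentiates to a nonzero value, among the given functions, only the
  -- conjugate of f a. This gives both the independence of the fields and the nondegeneracy of the
  -- pairing.
  let c : κ → κ := fun a => ⟨⟨conjIndex a.1, (conjIndex_lt a.2).trans_le hn⟩, conjIndex_lt a.2⟩
  have hcc : ∀ a, c (c a) = a := fun a => Subtype.ext (Fin.ext (conjIndex_conjIndex _))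
  have hXf : ∀ a b : κ, fderiv ℝ (f b.1) p (X a p) = sympEntry n a.1 b.1 := fun a b => by
    rw [← poissonBracket_eq_fderiv]
    exact (hbr a.1 a.2 b.1 b.2).self_of_nhds
  have hXf0 : ∀ a b : κ, b ≠ c a → fderiv ℝ (f b.1) p (X a p) = 0 := fun a b hab => by
    rw [hXf, sympEntry_eq_zero]
    exact fun h => hab (Subtype.ext (Fin.ext h))
  have hXf1 : ∀ a : κ, fderiv ℝ (f (c a).1) p (X a p) ≠ 0 := fun a => by
    rw [hXf]
    exact sympEntry_ne_zero a.2
  have hcomm : ∀ a b, ∀ᶠ z in 𝓝 p, VectorField.lieBracket ℝ (X a) (X b) z = 0 := by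
    intro a b
    filter_upwards [(hbr a.1 a.2 b.1 b.2).eventually_nhds, hU.mem_nhds hp,
      (hf a.1 a.2).eventually, (hf b.1 b.2).eventually] with z h1 h2 h3 h4
    refine hJ.lieBracket_poissonField hU h2 h3 h4 ?_
    rw [EventuallyEq.fderiv_eq h1]
    exact fderiv_const_apply _
  have hind : LinearIndependent ℝ fun a => X a p := by
    refine linearIndependent_of_pairing
      (fun a => (fderiv ℝ (f (c a).1) p : Phase N →ₗ[ℝ] ℝ)) hXf1 fun a b hab => hXf0 b (c a) ?_
    intro h
    apply hab
    rw [← hcc a, h, hcc]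
  have hdual : ∀ d : κ → ℝ, (∀ a, ∑ b, d b * fderiv ℝ (f b.1) p (X a p) = 0) → d = 0 := by
    intro d hd
    funext b
    have h := hd (c b)
    rw [Finset.sum_eq_single b (fun b' _ hb' => by
      rw [hXf0 (c b) b' (by rwa [hcc]), mul_zero]) (by simp)] at h
    have h2 := hXf1 (c b)
    rw [hcc] at h2
    exact (mul_eq_zero.1 h).resolve_right h2
  obtain ⟨F, hF, hFσ, hFX, hFi⟩ := exists_coordinates (σ := fun a : κ => a.1)
    Subtype.val_injective (f := fun a => f a.1) (fun a => hf a.1 a.2)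
    (fun a => hJ.smoothNear_poissonField hU hp (hf a.1 a.2)) hcomm hind hdual
  refine ⟨F, hn, hF, hFi, ?_⟩
  simp only [eventually_all]
  intro i j hi
  have hFi' : F i = f i := hFσ ⟨i, hi⟩
  by_cases hj : j.val < 2 * n
  · rw [hFi', show F j = f j from hFσ ⟨j, hj⟩]
    exact hbr i hi j hj
  · filter_upwards [hFX ⟨i, hi⟩ j (by rintro ⟨a, rfl⟩; exact hj a.2)] with z hz
    rw [sympEntry_of_le_right (not_lt.1 hj), hFi', poissonBracket_eq_fderiv]
    exact hz

/-- The fields of the first 2n coordinates and of F a commute, all brackets among these functions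
being constant, and are independent thanks to F b. Straightening them gives a function G conjugate
to F a that commutes with the 2n old coordinates. -/
theorem exists_isPartialDarboux_succ (hJ : IsPoissonTensor U J) (hU : IsOpen U) {p : Phase N}
    (hp : p ∈ U) {n : ℕ} {F : Fin N → Phase N → ℝ} (hF : IsPartialDarboux J p n F) {a b : Fin N}
    (ha : 2 * n ≤ a.val) (hb : 2 * n ≤ b.val) (hab : poissonBracket J (F a) (F b) p ≠ 0) :
    ∃ F', IsPartialDarboux J p (n + 1) F' := by
  have hne : a ≠ b := by
    rintro rfl
    have := hJ.poissonBracket_swap hp (F a) (F a)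
    exact hab (by linarith)
  have hN : 2 * (n + 1) ≤ N := by
    have : a.val ≠ b.val := fun h => hne (Fin.ext h)
    omega
  have hbr : ∀ᶠ z in 𝓝 p, ∀ i j : Fin N, j.val < 2 * n →
      poissonBracket J (F i) (F j) z = sympEntry n i j := by
    filter_upwards [hF.bracket, hU.mem_nhds hp] with z h1 h2 i j hj
    rw [hJ.poissonBracket_swap h2, h1 j i hj, ← sympEntry_swap]
  let κ := {i : Fin N // i.val < 2 * n ∨ i = a}
  let X : κ → Phase N → Phase N := fun i => poissonField J (F i.1)
  -- Test functions for independence at p: the conjugate coordinate for an old index, and F b as a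
  -- stand-in for the still missing conjugate of F a.
  let c : κ → Fin N := fun i =>
    if h : i.1.val < 2 * n then ⟨conjIndex i.1, ((conjIndex_lt h).trans_le hF.le)⟩ else b
  have hconst : ∀ i j : κ, ∃ k : ℝ, ∀ᶠ z in 𝓝 p, poissonBracket J (F i.1) (F j.1) z = k := by
    intro i j
    rcases i.2 with hi | hi
    · exact ⟨_, hF.bracket.mono fun z hz => hz i.1 j.1 hi⟩
    · rcases j.2 with hj | hj
      · exact ⟨_, hbr.mono fun z hz => hz i.1 j.1 hj⟩
      · refine ⟨0, ?_⟩
        filter_upwards [hU.mem_nhds hp] with z hz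
        have := hJ.poissonBracket_swap hz (F a) (F a)
        rw [hi, hj]
        linarith
  have hcomm : ∀ i j, ∀ᶠ z in 𝓝 p, VectorField.lieBracket ℝ (X i) (X j) z = 0 := by
    intro i j
    obtain ⟨k, hk⟩ := hconst i j
    filter_upwards [hk.eventually_nhds, hU.mem_nhds hp,
      (hF.smooth i.1).eventually, (hF.smooth j.1).eventually] with z h1 h2 h3 h4
    refine hJ.lieBracket_poissonField hU h2 h3 h4 ?_
    rw [EventuallyEq.fderiv_eq h1]
    exact fderiv_const_apply _
  have hind : LinearIndependent ℝ fun i => X i p := by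
    refine linearIndependent_of_pairing
      (fun i => (fderiv ℝ (F (c i)) p : Phase N →ₗ[ℝ] ℝ)) (fun i => ?_) fun i j hij => ?_
    · change fderiv ℝ (F (c i)) p (poissonField J (F i.1) p) ≠ 0
      rw [← poissonBracket_eq_fderiv]
      by_cases hi : i.1.val < 2 * n
      · simp only [c, dif_pos hi]
        rw [hF.bracket.self_of_nhds _ _ hi]
        exact sympEntry_ne_zero hi
      · simp only [c, dif_neg hi]
        rwa [i.2.resolve_left hi]
    · change fderiv ℝ (F (c i)) p (poissonField J (F j.1) p) = 0
      rw [← poissonBracket_eq_fderiv]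
      by_cases hi : i.1.val < 2 * n
      · simp only [c, dif_pos hi]
        rw [hbr.self_of_nhds _ _ (conjIndex_lt hi), sympEntry_eq_zero]
        intro h
        apply hij
        have := congrArg conjIndex h
        rw [conjIndex_conjIndex, conjIndex_conjIndex] at this
        exact Subtype.ext (Fin.ext this)
      · simp only [c, dif_neg hi]
        have hj : j.1.val < 2 * n := by
          refine j.2.resolve_right fun h => hij (Subtype.ext ?_)
          rw [h, i.2.resolve_left hi]
        rw [hF.bracket.self_of_nhds _ _ hj, sympEntry_of_le_right hb]
  obtain ⟨G, hG, hGX⟩ := exists_conjugate_first_integral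
    (fun i : κ => hJ.smoothNear_poissonField hU hp (hF.smooth i.1)) hcomm hind ⟨a, Or.inr rfl⟩
  have hG0 : ∀ i : Fin N, i.val < 2 * n → ∀ᶠ z in 𝓝 p, poissonBracket J (F i) G z = 0 := by
    intro i hi
    filter_upwards [hGX] with z hz
    rw [poissonBracket_eq_fderiv, hz ⟨i, Or.inl hi⟩, if_neg]
    intro h
    have : i = a := congrArg Subtype.val h
    omega
  have hGa : ∀ᶠ z in 𝓝 p, poissonBracket J (F a) G z = 1 := by
    filter_upwards [hGX] with z hz
    rw [poissonBracket_eq_fderiv, hz ⟨a, Or.inr rfl⟩, if_pos rfl]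
  -- The new pair F a, G takes the slots 2n and 2n + 1, in the order that gives the canonical sign.
  let f : ℕ → Phase N → ℝ := fun i =>
    if h : i < 2 * n then F ⟨i, h.trans_le hF.le⟩ else if i = 2 * n then F a else G
  have hf1 : ∀ i (h : i < 2 * n), f i = F ⟨i, h.trans_le hF.le⟩ := fun i h => dif_pos h
  have hf2 : f (2 * n) = F a := by simp [f]
  have hf3 : f (2 * n + 1) = G := by simp [f]
  have hcases : ∀ i < 2 * (n + 1), i < 2 * n ∨ i = 2 * n ∨ i = 2 * n + 1 := by omega
  have hupper : ∀ i < 2 * (n + 1), ∀ j < 2 * (n + 1), i ≤ j → ∀ᶠ z in 𝓝 p,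
      poissonBracket J (f i) (f j) z = sympEntry (n + 1) i j := by
    intro i hi j hj hij
    rcases hcases i hi with h | rfl | rfl
    · rw [sympEntry_succ h, hf1 i h]
      rcases hcases j hj with h' | rfl | rfl
      · rw [hf1 j h']
        exact hF.bracket.mono fun z hz => hz _ _ h
      · rw [hf2, sympEntry_of_le_right le_rfl]
        refine hF.bracket.mono fun z hz => ?_
        rw [hz _ _ h, sympEntry_of_le_right ha]
      · rw [hf3, sympEntry_of_le_right (by omega)]
        exact hG0 _ h
    · rcases hcases j hj with h' | rfl | rfl
      · omega
      · rw [sympEntry_eq_zero (conjIndex_ne _).symm]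
        filter_upwards [hU.mem_nhds hp] with z hz
        have := hJ.poissonBracket_swap hz (f (2 * n)) (f (2 * n))
        linarith
      · rw [hf2, hf3]
        have : sympEntry (n + 1) (2 * n) (2 * n + 1) = 1 := by
          simp [sympEntry, conjIndex]
        rwa [this]
    · obtain rfl : j = 2 * n + 1 := by omega
      rw [sympEntry_eq_zero (conjIndex_ne _).symm]
      filter_upwards [hU.mem_nhds hp] with z hz
      have := hJ.poissonBracket_swap hz (f (2 * n + 1)) (f (2 * n + 1))
      linarith
  refine hJ.exists_isPartialDarboux hU hp hN (f := f) (fun i hi => ?_) fun i hi j hj => ?_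
  · rcases hcases i hi with h | rfl | rfl
    · rw [hf1 i h]
      exact hF.smooth _
    · rw [hf2]
      exact hF.smooth _
    · rwa [hf3]
  · rcases le_total i j with h | h
    · exact hupper i hi j hj h
    · filter_upwards [hupper j hj i hi h, hU.mem_nhds hp] with z h1 h2
      rw [hJ.poissonBracket_swap h2, h1, ← sympEntry_swap]

end IsPoissonTensor

end Darboux

/-! ### Darboux's theorem and the count of Poisson classes. -/

section Classification

variable {N : ℕ} {J : BiTensor N} {U : Set (Phase N)}

/-- A coordinate change acts on the Poisson matrix by congruence with the invertible Jacobian. -/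
theorem rank_pushPoisson {h : OpenPartialHomeomorph (Phase N) (Phase N)} (hh : IsCoordChange h)
    (J : BiTensor N) {z : Phase N} (hz : z ∈ h.source) :
    (pushPoisson h J (h z)).rank = (J z).rank := by
  have h1 := jac_symm_mul hh hz
  have hdet : IsUnit (jac h z).det := by
    have h2 := congrArg Matrix.det h1
    rw [Matrix.det_mul, Matrix.det_one] at h2
    exact IsUnit.of_mul_eq_one _ (by rw [mul_comm]; exact h2)
  rw [pushPoisson_eq, h.left_inv hz, Matrix.rank_mul_eq_left_of_isUnit_det _ _
    (by rwa [Matrix.det_transpose]), Matrix.rank_mul_eq_right_of_isUnit_det _ _ hdet]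

namespace IsPoissonTensor

/-- **Darboux's theorem** for Poisson tensors of constant rank. -/
theorem exists_darboux (hJ : IsPoissonTensor U J) (hU : IsOpen U) {r : ℕ}
    (hr : ∀ z ∈ U, (J z).rank = r) {p : Phase N} (hp : p ∈ U) :
    ∃ n, 2 * n ≤ N ∧ ∃ F : Fin N → Phase N → ℝ, (∀ i, SmoothNear (F i) p) ∧
      (LinearIndependent ℝ fun i => fderiv ℝ (F i) p) ∧
      ∀ᶠ z in 𝓝 p, ∀ i j : Fin N, poissonBracket J (F i) (F j) z = sympEntry n i j := by
  -- The bound 2n ≤ N stops the splitting, so some n admits no further pair.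
  obtain ⟨n, F, hF, hmax⟩ : ∃ n F, IsPartialDarboux J p n F ∧
      ¬ ∃ F', IsPartialDarboux J p (n + 1) F' := by
    by_contra! hcon
    have : ∀ n, ∃ F, IsPartialDarboux J p n F := by
      intro n
      induction n with
      | zero => exact ⟨_, isPartialDarboux_zero J p⟩
      | succ n ih =>
        obtain ⟨F, hF⟩ := ih
        exact hcon n F hF
    obtain ⟨F, hF⟩ := this (N + 1)
    have := hF.le
    omega
  have hzero : ∀ i j : Fin N, 2 * n ≤ i.val → 2 * n ≤ j.val →
      poissonBracket J (F i) (F j) p = 0 := by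
    intro i j hi hj
    by_contra hne
    exact hmax (hJ.exists_isPartialDarboux_succ hU hp hF hi hj hne)
  obtain ⟨h, hh, hpz, hs, hhF⟩ := exists_isCoordChange hF.smooth hF.indep
    (inter_mem (hU.mem_nhds hp) hF.bracket)
  have hfun : ∀ i, (fun z => h z i) = F i := fun i => funext fun z => hhF z i
  have hpush : ∀ z ∈ h.source, ∀ i j, pushPoisson h J (h z) i j =
      poissonBracket J (F i) (F j) z := by
    intro z hz i j
    rw [pushPoisson, Matrix.of_apply, hfun, hfun, h.left_inv hz]
  have hrank : ∀ z ∈ h.source, (pushPoisson h J (h z)).rank = r := fun z hz => by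
    rw [rank_pushPoisson hh J hz, hr z (hs hz).1]
  -- At p itself the matrix is already canonical, which identifies the constant rank r with that of
  -- the canonical matrix. Near p only the first 2n rows are known, and the rank takes care of the
  -- remaining block.
  have hp0 : pushPoisson h J (h p) = sympMatrix N n := by
    ext i j
    rw [hpush p hpz]
    change _ = sympEntry n i j
    by_cases hi : i.val < 2 * n
    · exact hF.bracket.self_of_nhds i j hi
    · rw [sympEntry_of_le (not_lt.1 hi)]
      by_cases hj : j.val < 2 * n
      · rw [hJ.poissonBracket_swap hp, hF.bracket.self_of_nhds j i hj,
          sympEntry_of_le_right (not_lt.1 hi), neg_zero]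
      · exact hzero i j (not_lt.1 hi) (not_lt.1 hj)
  refine ⟨n, hF.le, F, hF.smooth, hF.indep, ?_⟩
  filter_upwards [h.open_source.mem_nhds hpz] with z hz i j
  rw [← hpush z hz]
  have heq : pushPoisson h J (h z) = sympMatrix N n := by
    apply eq_sympMatrix_of_rank_eq
    · intro i j
      rw [hpush z hz, hpush z hz, hJ.poissonBracket_swap (hs hz).1]
    · intro i j hi
      rw [hpush z hz]
      exact (hs hz).2 i j hi
    · rw [hrank z hz, ← hp0, hrank p hpz]
  rw [heq]
  rfl

end IsPoissonTensor

/-- The part of an iterated bracket with constant coefficients `M` that contains the second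
derivatives `a` of one of the functions. -/
def secondOrderPart (M a : Matrix (Fin N) (Fin N) ℝ) (b d : Fin N → ℝ) : ℝ :=
  ∑ x : Fin N × Fin N, ∑ y : Fin N × Fin N,
    M x.1 x.2 * M y.1 y.2 * a x.1 y.1 * b y.2 * d x.2

/-- Exchange the two summation pairs and use the symmetry of second derivatives. -/
theorem secondOrderPart_swap (M : Matrix (Fin N) (Fin N) ℝ) {a : Matrix (Fin N) (Fin N) ℝ}
    (ha : ∀ i j, a i j = a j i) (b d : Fin N → ℝ) :
    secondOrderPart M a b d = secondOrderPart M a d b := by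
  unfold secondOrderPart
  rw [Finset.sum_comm]
  refine Finset.sum_congr rfl fun x _ => Finset.sum_congr rfl fun y _ => ?_
  rw [ha]
  ring

theorem pderiv_poissonBracket_const (M : Matrix (Fin N) (Fin N) ℝ) {A B : Phase N → ℝ}
    {z : Phase N} (hA : SmoothNear A z) (hB : SmoothNear B z) (k : Fin N) :
    pderiv k (poissonBracket (fun _ => M) A B) z =
      ∑ i, ∑ j, (M i j * pderiv k (pderiv i A) z * pderiv j B z +
        M i j * pderiv i A z * pderiv k (pderiv j B) z) := by
  have h : HasFDerivAt (poissonBracket (fun _ => M) A B) _ z :=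
    HasFDerivAt.fun_sum (u := Finset.univ) fun i _ => HasFDerivAt.fun_sum (u := Finset.univ)
      fun j _ => (((hA.pderiv i).differentiableAt.hasFDerivAt.const_mul (M i j)).mul
        (hB.pderiv j).differentiableAt.hasFDerivAt)
  rw [pderiv, h.fderiv]
  simp only [_root_.sum_apply, _root_.add_apply, _root_.smul_apply, smul_eq_mul]
  refine Finset.sum_congr rfl fun i _ => Finset.sum_congr rfl fun j _ => ?_
  rw [← pderiv, ← pderiv]
  ring

/-- The product rule gives two terms; antisymmetry of M brings the one with second derivatives of B
to the same shape, with a minus sign. -/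
theorem poissonBracket_poissonBracket_const {M : Matrix (Fin N) (Fin N) ℝ}
    (hM : ∀ i j, M j i = -M i j) {A B : Phase N → ℝ} (D : Phase N → ℝ) {z : Phase N}
    (hA : SmoothNear A z) (hB : SmoothNear B z) :
    poissonBracket (fun _ => M) (poissonBracket (fun _ => M) A B) D z =
      secondOrderPart M (fun i j => pderiv i (pderiv j A) z) (fun i => pderiv i B z)
        (fun i => pderiv i D z) -
      secondOrderPart M (fun i j => pderiv i (pderiv j B) z) (fun i => pderiv i A z)
        (fun i => pderiv i D z) := by
  rw [poissonBracket]
  unfold secondOrderPart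
  rw [← Finset.sum_sub_distrib, Fintype.sum_prod_type]
  refine Finset.sum_congr rfl fun k _ => Finset.sum_congr rfl fun l _ => ?_
  rw [pderiv_poissonBracket_const M hA hB k, Fintype.sum_prod_type, Fintype.sum_prod_type]
  have h1 : ∑ i, ∑ j, M k l * M i j * pderiv k (pderiv i B) z * pderiv j A z * pderiv l D z =
      ∑ i, ∑ j, M k l * M j i * pderiv k (pderiv j B) z * pderiv i A z * pderiv l D z :=
    Finset.sum_comm
  rw [h1, ← Finset.sum_sub_distrib, Finset.mul_sum, Finset.sum_mul]
  refine Finset.sum_congr rfl fun i _ => ?_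
  rw [← Finset.sum_sub_distrib, Finset.mul_sum, Finset.sum_mul]
  refine Finset.sum_congr rfl fun j _ => ?_
  rw [hM i j]
  ring

/-- The cyclic sum has six second-order terms, two for each function and of opposite signs; they
cancel by `secondOrderPart_swap`. -/
theorem isPoissonTensor_const {M : Matrix (Fin N) (Fin N) ℝ} (hM : ∀ i j, M j i = -M i j) :
    IsPoissonTensor Set.univ fun _ : Phase N => M where
  smooth _ _ := contDiffOn_const
  antisymm _ _ := hM
  jacobi A B D hA hB hD z _ := by
    have hs : ∀ {A : Phase N → ℝ}, IsObservable Set.univ A → SmoothNear A z := fun hA =>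
      .of_contDiffOn hA isOpen_univ (Set.mem_univ z)
    rw [poissonBracket_poissonBracket_const hM D (hs hA) (hs hB),
      poissonBracket_poissonBracket_const hM B (hs hD) (hs hA),
      poissonBracket_poissonBracket_const hM A (hs hB) (hs hD),
      secondOrderPart_swap M (pderiv_comm (hs hA).self) (fun i => pderiv i D z),
      secondOrderPart_swap M (pderiv_comm (hs hB).self) (fun i => pderiv i D z),
      secondOrderPart_swap M (pderiv_comm (hs hD).self) (fun i => pderiv i B z)]
    ring

/-- The model Poisson bracket at the origin with `n` pairs of conjugate variables. -/
def modelPoisson {n : ℕ} (h0 : n ≠ 0) (hn : 2 * n ≤ N) : LocalPoisson N where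
  dom := Set.univ
  isOpen_dom := isOpen_univ
  base := 0
  base_mem := Set.mem_univ _
  tensor := fun _ => sympMatrix N n
  isPoisson := isPoissonTensor_const fun i j => sympEntry_swap n i j
  rank_const := ⟨2 * n, by omega, fun _ _ => rank_sympMatrix hn⟩

theorem rank_eq_of_poissonEquiv {a b : LocalPoisson N} (hab : PoissonEquiv a b) :
    (a.tensor a.base).rank = (b.tensor b.base).rank := by
  obtain ⟨h, hh, hT⟩ := hab
  rw [← rank_pushPoisson hh.coord _ hh.mem_source, hh.map_base]
  congr 1
  ext i j
  exact hT _ (hh.map_base ▸ h.map_source hh.mem_source) i j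

theorem exists_poissonEquiv_model (a : LocalPoisson N) :
    ∃ (n : ℕ) (h0 : n ≠ 0) (hn : 2 * n ≤ N), PoissonEquiv a (modelPoisson h0 hn) := by
  obtain ⟨r, hr0, hr⟩ := a.rank_const
  obtain ⟨n, hn, F, hF, hFi, hFJ⟩ := a.isPoisson.exists_darboux a.isOpen_dom hr a.base_mem
  obtain ⟨h, hh, hs, hhF⟩ := exists_isCoordChangeBetween hF hFi
    (a.isOpen_dom.mem_nhds a.base_mem) hFJ
  have hpush : ∀ x ∈ h.target, pushPoisson h a.tensor x = sympMatrix N n := by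
    intro x hx
    ext i j
    rw [pushPoisson, Matrix.of_apply, poissonBracket_congr_fderiv (hhF _ i) (hhF _ j)]
    exact hs (h.map_target hx) i j
  have h0 : n ≠ 0 := by
    rintro rfl
    have h1 := rank_pushPoisson hh.coord a.tensor hh.mem_source
    rw [hpush _ (h.map_source hh.mem_source), rank_sympMatrix hn, hr _ a.base_mem] at h1
    exact hr0 h1.symm
  exact ⟨n, h0, hn, h, hh, fun x hx i j => by rw [hpush x hx]; rfl⟩

/-- The rank separates the models and Darboux's theorem reaches every class. Finiteness is recorded
separately because `Nat.card` is also 0 on infinite types, which matters for N ≤ 1. -/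
theorem card_poissonClass (N : ℕ) :
    Finite (PoissonClass N) ∧ Nat.card (PoissonClass N) = N / 2 := by
  let f : Fin (N / 2) → PoissonClass N := fun n =>
    -- The number of pairs starts at 1, since rank zero is excluded.
    Quotient.mk _ (modelPoisson (n := n.val + 1) (by omega) (by omega))
  have hf : Function.Bijective f := by
    constructor
    · intro m n hmn
      have h1 := rank_eq_of_poissonEquiv (Quotient.exact hmn)
      have h2 : ∀ k : Fin (N / 2), (sympMatrix N (k.val + 1)).rank = 2 * (k.val + 1) := fun k =>
        rank_sympMatrix (by omega)
      have h3 : 2 * (m.val + 1) = 2 * (n.val + 1) := (h2 m).symm.trans (h1.trans (h2 n))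
      exact Fin.ext (by omega)
    · intro y
      induction y using Quotient.inductionOn with
      | h a =>
        obtain ⟨n, h0, hn, hequiv⟩ := exists_poissonEquiv_model a
        obtain ⟨k, rfl⟩ := Nat.exists_eq_succ_of_ne_zero h0
        refine ⟨⟨k, by omega⟩, ?_⟩
        exact (Quotient.sound hequiv).symm
  exact ⟨Finite.of_surjective f hf.2, by
    rw [← Nat.card_eq_of_bijective f hf, Nat.card_eq_fintype_card, Fintype.card_fin]⟩

end Classification

end NambuLocal

end

theorem mainTheorem2 (N : ℕ) :
    (∀ (K : ℕ), N = K + 2 →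
      ∀ (U : Set (NambuLocal.Phase N)) (J : NambuLocal.BiTensor N)
        (T : NambuLocal.TriTensor N) (C : NambuLocal.Phase N → ℝ),
        IsOpen U →
        NambuLocal.IsPoissonTensor U J →
        (∀ z ∈ U, (J z).rank + K = N) →
        NambuLocal.IsNambuTensor U T →
        NambuLocal.IsObservable U C →
        NambuLocal.GeneratedBy U J T C →
        ∀ z₀ ∈ U, ∃ h : OpenPartialHomeomorph (NambuLocal.Phase N) (NambuLocal.Phase N),
          NambuLocal.IsCoordChange h ∧ z₀ ∈ h.source ∧ h.source ⊆ U ∧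
          (∀ x ∈ h.target, ∀ l : Fin N, l.val + 1 = N → C (h.symm x) = x l) ∧
          (∀ x ∈ h.target, NambuLocal.pushPoisson h J x = NambuLocal.canonicalPoisson N) ∧
          (∀ x ∈ h.target, ∀ i j k : Fin N,
            NambuLocal.pushNambu h T x i j k = NambuLocal.leviCivita N i j k)) ∧
    (3 ≤ N → Nat.card (NambuLocal.NambuClass N) = 1) ∧
    (Finite (NambuLocal.PoissonClass N) ∧
      Nat.card (NambuLocal.PoissonClass N) = N / 2) := by
  refine ⟨?_, NambuLocal.card_nambuClass, NambuLocal.card_poissonClass N⟩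
  intro K hK U J T C hU _ hrank hT hC hJ z₀ hz₀
  -- The rank enters only through J z₀ ≠ 0: a zero matrix would give K = N, against N = K + 2.
  refine NambuLocal.exists_normal_form_of_generatedBy hU hT hC hJ hz₀ fun h0 => ?_
  have hr := hrank z₀ hz₀
  rw [h0, Matrix.rank_zero] at hr
  omega
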